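/- **Setting.** Let $\phi_\ell(t)=e^{-t/2}\sum_{j=0}^{\ell}(-1)^j\binom{\ell}{j}\frac{t^j}{j!}$ ($\ell\ge 0$) be the Laguerre functions on $\mathbb{R}_+$, and write $\check h_\ell=\int_0^\infty h\,\phi_\ell$ and $h^\ell=(\check h_0,\dots,\check h_\ell)$. For $g\in L^2(\mathbb{R}_+)$ let $\mathbf{K}h(t)=\int_0^t g(t-\tau)h(\tau)\,d\tau$, and let $K^\ell=(\langle \mathbf{K}\phi_j,\phi_i\rangle)_{0\le i,j\le \ell}$ be its Galerkin matrices. Let $\|\cdot\|_{\mathrm{op}}$ be the spectral norm. *Classes.* For $s>1/2$, $M\ge 0$, let $\mathcal{W}^s(M)$ be the set of $f\in L^2(\mathbb{R}_+)$ with $\sum_{\ell\ge0}|(\ell+\tfrac12)^s\check f_\ell|^2\le M^2$. For $\nu,Q\ge 0$, let $\mathcal{K}_\nu(Q)$ be the set of $g\in L^2(\mathbb{R}_+)$ such that, for all $\ell\ge 0$, $K^\ell$ is invertible and $\|(K^\ell)^{-1}\|_{\mathrm{op}}\le Q(\ell\vee 1)^\nu$. *Observations.* Let $n\ge1$, $T,\sigma,\delta>0$,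 let $0\le t_1\le\dots\le t_n\le T$ be design points, and put $\varepsilon=\sigma\sqrt{T/n}$, $\Phi_\ell=(\phi_k(t_i))_{0\le k\le\ell,\,1\le i\le n}$ and $\Omega_\ell=\frac nT(\Phi_\ell\,{}^t\Phi_\ell)^{-1}$. One observes $$y^\ell=K^\ell f^\ell+\varepsilon\,\xi_\ell,\qquad K_\delta^\ell=K^\ell+\delta B^\ell ,$$ where $\xi_\ell\sim\mathcal N(0,\Omega_\ell)$, $B^\ell=(b_{i-j}\mathbf 1_{i\ge j})_{0\le i,j\le\ell}$ with $b_0,b_1,\dots$ i.i.d. standard Gaussian, and $\xi_\ell$ is independent of $(b_k)_{k\ge0}$. *Algorithm I.* Given $\lambda,\kappa,\tau_{\mathrm{sig}},\tau_{\mathrm{op}}>0$, put $$L=\lambda\big(\varepsilon\sqrt{|\log\varepsilon|}\vee\delta|\log\delta|\big)^{-\frac1{\nu+1}},\qquad O_\ell=\kappa\big((\ell\vee1)\log(\ell\vee2)\big)^{1/2}\delta\sqrt{|\log\delta|},$$ $$S_\ell=(\ell\vee1)^\nu\big(\tau_{\mathrm{sig}}\,\varepsilon\sqrt{|\log\varepsilon|}\vee\tau_{\mathrm{op}}\,\delta|\log\delta|\big).$$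 Let $\zeta_\ell$ be the coordinate of index $\ell$ of $(K_\delta^\ell)^{-1}y^\ell$ if $K_\delta^\ell$ is invertible and $\|(K_\delta^\ell)^{-1}\|_{\mathrm{op}}<O_\ell^{-1}$, and $\zeta_\ell=0$ otherwise. The estimator is $$\widetilde f=\sum_{0\le \ell\le L}\zeta_\ell\,\mathbf 1_{\{|\zeta_\ell|>S_\ell\}}\,\phi_\ell .$$ **Theorem.** Let $s>1/2$, $M\ge0$, $\nu\ge0$, $Q\ge0$, $\lambda>0$, $C\ge0$. There is $R>0$, depending only on these parameters, such that for all $\kappa,\tau_{\mathrm{sig}},\tau_{\mathrm{op}}\ge R$ there is a constant $A>0$, depending only on $\lambda,\kappa,\tau_{\mathrm{sig}},\tau_{\mathrm{op}},s,M,\nu,Q,C$, with the following property. For all $n,\sigma,T,\delta$ and all designs as above such that $\delta,\varepsilon\in(0,\tfrac12]$ and such that, for every integer $0\le\ell\le L$, $\Phi_\ell\,{}^t\Phi_\ell$ is invertible and all eigenvalues of $\Omega_\ell$ are at most $C$, $$\sup_{f\in\mathcal W^s(M),\;g\in\mathcal K_\nu(Q)}\mathbb E\,\|\widetilde f-f\|_{L^2(\mathbb{R}_+)}\;\le\;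 A\,\Big[\big(\delta|\log\delta|\big)^{\frac{2s}{2(s+\nu)+1}}\vee\big(\varepsilon\sqrt{|\log\varepsilon|}\big)^{\frac{2s}{2(s+\nu)+1}}\Big].$$ -/

import Mathlib

open MeasureTheory ProbabilityTheory
open scoped ENNReal

namespace LaplaceDeconv

noncomputable section

/-! ### Laguerre functions and the Laplace convolution operator -/

/-- Laguerre polynomial `L_ℓ(t) = ∑_{j ≤ ℓ} (-1)^j (ℓ choose j) t^j / j!`. -/
def laguerrePoly (l : ℕ) (t : ℝ) : ℝ :=
  ∑ j ∈ Finset.range (l + 1), (-1 : ℝ) ^ j * (l.choose j : ℝ) * t ^ j / (j.factorial : ℝ)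

/-- Laguerre function `φ_ℓ(t) = e^{-t/2} L_ℓ(t)`. -/
def laguerreFun (l : ℕ) (t : ℝ) : ℝ := Real.exp (-t / 2) * laguerrePoly l t

/-- Lebesgue measure on the half line `(0, ∞)`. -/
def halfLine : Measure ℝ := volume.restrict (Set.Ioi 0)

/-- Laguerre coefficient `⟨h, φ_ℓ⟩ = ∫_0^∞ h φ_ℓ`. -/
def coeff (h : ℝ → ℝ) (l : ℕ) : ℝ := ∫ t, h t * laguerreFun l t ∂halfLine

/-- Laplace convolution operator with kernel `g`: `(K h)(t) = ∫_0^t g(t - τ) h(τ) dτ`. -/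
def convOp (g h : ℝ → ℝ) (t : ℝ) : ℝ := ∫ τ in (0 : ℝ)..t, g (t - τ) * h τ

/-- Galerkin matrix `(K^ℓ)_{i,j} = ⟨K φ_j, φ_i⟩`, `0 ≤ i, j ≤ ℓ`. -/
def galerkin (g : ℝ → ℝ) (l : ℕ) : Matrix (Fin (l + 1)) (Fin (l + 1)) ℝ :=
  Matrix.of fun i j => coeff (convOp g (laguerreFun j)) i

/-- Truncated lower triangular Toeplitz matrix `T_ℓ(a)` of a sequence `a = (a_0, a_1, …)`. -/
def toeplitz (a : ℕ → ℝ) (l : ℕ) : Matrix (Fin (l + 1)) (Fin (l + 1)) ℝ :=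
  Matrix.of fun i j => if (j : ℕ) ≤ (i : ℕ) then a ((i : ℕ) - (j : ℕ)) else 0

/-- Spectral norm of a real square matrix. -/
def opNorm {m : ℕ} (A : Matrix (Fin m) (Fin m) ℝ) : ℝ := ‖Matrix.toEuclideanCLM (𝕜 := ℝ) A‖

/-! ### Function classes -/

/-- Laguerre–Sobolev ball: square integrable functions on the half line with
`∑_ℓ |(ℓ + 1/2)^s ⟨f, φ_ℓ⟩|² ≤ M²`. -/
def sobolevBall (s M : ℝ) : Set (ℝ → ℝ) :=
  {f | MemLp f 2 halfLine ∧
    Summable (fun l : ℕ => (((l : ℝ) + 1 / 2) ^ s * coeff f l) ^ 2) ∧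
    ∑' l : ℕ, (((l : ℝ) + 1 / 2) ^ s * coeff f l) ^ 2 ≤ M ^ 2}

/-- Kernels `g` in `L²(0, ∞)` with degree of ill-posedness `ν`: all Galerkin matrices are
invertible and `‖(K^ℓ)⁻¹‖_op ≤ Q (ℓ ∨ 1)^ν` for all `ℓ`. -/
def kernelClass (ν Q : ℝ) : Set (ℝ → ℝ) :=
  {g | MemLp g 2 halfLine ∧
    ∀ l : ℕ, IsUnit (galerkin g l) ∧ opNorm (galerkin g l)⁻¹ ≤ Q * (max (l : ℝ) 1) ^ ν}

/-! ### The design -/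

/-- The `(ℓ+1) × n` matrix `Φ_ℓ` with entries `φ_k(t_i)`. -/
def designMatrix {n : ℕ} (t : Fin n → ℝ) (l : ℕ) : Matrix (Fin (l + 1)) (Fin n) ℝ :=
  Matrix.of fun k i => laguerreFun k (t i)

/-- The Gram matrix of the design, with entries `∑_i φ_k(t_i) φ_m(t_i)`, `0 ≤ k, m ≤ ℓ`. -/
def designGram {n : ℕ} (t : Fin n → ℝ) (l : ℕ) : Matrix (Fin (l + 1)) (Fin (l + 1)) ℝ :=
  designMatrix t l * (designMatrix t l).transpose

/-- The covariance matrix `Ω_ℓ`: `n / T` times the inverse Gram matrix. -/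
def designCov {n : ℕ} (T : ℝ) (t : Fin n → ℝ) (l : ℕ) :
    Matrix (Fin (l + 1)) (Fin (l + 1)) ℝ :=
  ((n : ℝ) / T) • (designGram t l)⁻¹

/-- The design is well conditioned up to level `L`: for all `ℓ ≤ L`, the covariance `Ω_ℓ` is well
defined and all its eigenvalues are at most `C`. -/
def WellConditioned {n : ℕ} (T : ℝ) (t : Fin n → ℝ) (L C : ℝ) : Prop :=
  ∀ l : ℕ, (l : ℝ) ≤ L →
    IsUnit (designGram t l) ∧ ∀ μ ∈ spectrum ℝ (designCov T t l), μ ≤ C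

/-! ### Levels, thresholds and Algorithm I -/

/-- `ε √|log ε|`. -/
def signalSize (ε : ℝ) : ℝ := ε * Real.sqrt |Real.log ε|

/-- `δ |log δ|`. -/
def operatorSize (δ : ℝ) : ℝ := δ * |Real.log δ|

/-- Maximal level `L = lam (ε √|log ε| ∨ δ |log δ|)^{-1/(ν+1)}` (a real number). -/
def maxLevel (lam ν ε δ : ℝ) : ℝ :=
  lam * (max (signalSize ε) (operatorSize δ)) ^ (-1 / (ν + 1))

/-- Operator threshold `O_{ℓ,δ} = κ ((ℓ ∨ 1) log (ℓ ∨ 2))^{1/2} δ √|log δ|`. -/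
def opThreshold (κ δ : ℝ) (l : ℕ) : ℝ :=
  κ * Real.sqrt (max (l : ℝ) 1 * Real.log (max (l : ℝ) 2)) * (δ * Real.sqrt |Real.log δ|)

/-- Signal threshold `S_ℓ = (ℓ ∨ 1)^ν (τ_sig ε √|log ε| ∨ τ_op δ |log δ|)`. -/
def sigThreshold (ν τsig τop ε δ : ℝ) (l : ℕ) : ℝ :=
  (max (l : ℝ) 1) ^ ν * max (τsig * signalSize ε) (τop * operatorSize δ)

open Classical in
/-- `ζ_ℓ`, computed from a noisy matrix `A = K_δ^ℓ` and data `y = y^ℓ`: the coordinate of index `ℓ`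
of `A⁻¹ y` if `‖A⁻¹‖_op < O_{ℓ,δ}⁻¹`, and `0` otherwise (also when `A` is not invertible). -/
def zeta (κ δ : ℝ) (l : ℕ) (A : Matrix (Fin (l + 1)) (Fin (l + 1)) ℝ)
    (y : Fin (l + 1) → ℝ) : ℝ :=
  if IsUnit A ∧ opNorm A⁻¹ < (opThreshold κ δ l)⁻¹ then
    (A⁻¹.mulVec y) (Fin.last l)
  else 0

open Classical in
/-- Algorithm I, as a function of the data `(K_δ^ℓ, y^ℓ)_ℓ`:
`∑_{ℓ ≤ L} ζ_ℓ 1{|ζ_ℓ| > S_ℓ} φ_ℓ`, where `L` is the maximal level. -/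
def algorithmI (lam κ τsig τop ν ε δ : ℝ)
    (A : (l : ℕ) → Matrix (Fin (l + 1)) (Fin (l + 1)) ℝ) (y : (l : ℕ) → Fin (l + 1) → ℝ)
    (x : ℝ) : ℝ :=
  ∑ l ∈ Finset.range (⌊maxLevel lam ν ε δ⌋₊ + 1),
    if sigThreshold ν τsig τop ε δ l < |zeta κ δ l (A l) (y l)| then
      zeta κ δ l (A l) (y l) * laguerreFun l x
    else 0

/-! ### Observations and risk -/

/-- Noise level `ε = σ √(T / n)`. -/
def noiseLevel (σ T : ℝ) (n : ℕ) : ℝ := σ * Real.sqrt (T / n)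

/-- Observed operator `K_δ^ℓ = K^ℓ + δ T_ℓ(b)`. -/
def noisyOperator (g : ℝ → ℝ) (δ : ℝ) (b : ℕ → ℝ) (l : ℕ) :
    Matrix (Fin (l + 1)) (Fin (l + 1)) ℝ :=
  galerkin g l + δ • toeplitz b l

/-- Observed signal `y^ℓ = K^ℓ f^ℓ + ε ξ_ℓ`, where `f^ℓ = (⟨f, φ_k⟩)_{k ≤ ℓ}`. -/
def noisySignal (f g : ℝ → ℝ) (ε : ℝ) (ξ : (l : ℕ) → EuclideanSpace ℝ (Fin (l + 1)))
    (l : ℕ) (i : Fin (l + 1)) : ℝ :=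
  (galerkin g l).mulVec (fun k => coeff f k) i + ε * ξ l i

/-- The noise up to level `L`: `b_0, b_1, …` are i.i.d. standard Gaussian and, for each `ℓ ≤ L`,
the vector `ξ_ℓ` has law `N(0, Ω_ℓ)` and is independent of `b`. -/
structure IsNoise {Ω : Type*} [MeasurableSpace Ω] (P : Measure Ω) {n : ℕ} (T : ℝ)
    (t : Fin n → ℝ) (L : ℝ) (b : ℕ → Ω → ℝ)
    (ξ : (l : ℕ) → Ω → EuclideanSpace ℝ (Fin (l + 1))) : Prop where
  law_b : ∀ k, HasLaw (b k) (gaussianReal 0 1) P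
  indep_b : iIndepFun b P
  law_ξ : ∀ l : ℕ, (l : ℝ) ≤ L → HasLaw (ξ l) (multivariateGaussian 0 (designCov T t l)) P
  indep_ξ : ∀ l : ℕ, (l : ℝ) ≤ L → IndepFun (fun ω k => b k ω) (ξ l) P

/-- The risk `E ‖f̃ - f‖` of Algorithm I, with the norm of `L²(0, ∞)`. -/
def riskI {Ω : Type*} [MeasurableSpace Ω] (P : Measure Ω) (lam κ τsig τop ν ε δ : ℝ)
    (b : ℕ → Ω → ℝ) (ξ : (l : ℕ) → Ω → EuclideanSpace ℝ (Fin (l + 1))) (f g : ℝ → ℝ) : ℝ≥0∞ :=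
  ∫⁻ ω, eLpNorm
    (fun x => algorithmI lam κ τsig τop ν ε δ
      (noisyOperator g δ (fun k => b k ω)) (noisySignal f g ε (fun l => ξ l ω)) x - f x)
    2 halfLine ∂P

/-- The rate `(δ |log δ|)^{2s/(2(s+ν)+1)} ∨ (ε √|log ε|)^{2s/(2(s+ν)+1)}`. -/
def rateI (s ν ε δ : ℝ) : ℝ :=
  max (operatorSize δ ^ (2 * s / (2 * (s + ν) + 1)))
    (signalSize ε ^ (2 * s / (2 * (s + ν) + 1)))

end

end LaplaceDeconv

open LaplaceDeconv

/-! The Laguerre functions form an orthonormal basis of L²(0, ∞), so by Parseval the error is the ℓ²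
norm of the coefficient errors. Fix a level ℓ ≤ L, write K = K^ℓ, A = K + δB, q = Q(ℓ ∨ 1)^ν, and
let η be the larger of ε√|log ε| and δ|log δ|. When A is accepted, the error before thresholding is
the last coordinate of εA⁻¹ξ − δA⁻¹Bf.

On the event δ‖B‖ ≤ O_ℓ/2, acceptance forces ‖A⁻¹‖ ≤ 2q. The resolvent identity then replaces δA⁻¹Bf
by δK⁻¹Bf plus a remainder quadratic in δ. The coordinate of K⁻¹Bf is a linear form in the Gaussian
sequence b, with variance at most (q ∑|f_j|)² by Young's inequality; s > 1/2 makes ∑|f_j| finite.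
The remainder is small because ℓ ≤ L. Hence, apart from rare events, both noises are below S_ℓ/4,
and hard thresholding errs by at most |f_ℓ| and at most 3S_ℓ/2. A rejected A costs |f_ℓ|; below a
small multiple of the cut-off η^(−γ), γ = 2/(2(s+ν)+1), rejection does not occur on this event.
Summing S_ℓ² below the cut-off and f_ℓ² above it gives the squared rate η^(2sγ).

Rare events: ‖B‖ is at most the maximum of the symbol over 2ℓ+2 roots of unity, whence a Gaussian
tail (`measure_lt_opNorm_toeplitz_le`). On the bad operator event the acceptance test still gives a
crude bound polynomial in 1/δ. Large signal noise is handled by a Chernoff bound after conditioning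
on b. Each level contributes O(δ² + ε²) (`exists_level_majorant`); summed over ℓ ≤ L this is O(η),
within the rate. `exists_hasSum_bias_variance` supplies the deterministic part and `riskI_le`
combines the two. -/

/-! ### Determinacy by moments. -/

/-- Two finite measures on `ℝ` with exponential moments near `0` and equal moments coincide. -/
theorem measure_ext_of_moments {μ ν : Measure ℝ} [IsFiniteMeasure μ] [IsFiniteMeasure ν]
    (hμ : (0 : ℝ) ∈ interior (integrableExpSet id μ))
    (hν : (0 : ℝ) ∈ interior (integrableExpSet id ν))
    (h : ∀ n : ℕ, ∫ x, x ^ n ∂μ = ∫ x, x ^ n ∂ν) : μ = ν := by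
  set U : Set ℝ := interior (integrableExpSet id μ) ∩ interior (integrableExpSet id ν)
  have hUc : Convex ℝ U :=
    convex_integrableExpSet.interior.inter convex_integrableExpSet.interior
  have hpre : IsPreconnected {z : ℂ | z.re ∈ U} :=
    (hUc.linear_preimage Complex.reLm).isPreconnected
  have hA : AnalyticOnNhd ℂ (complexMGF id μ) {z | z.re ∈ U} :=
    analyticOnNhd_complexMGF.mono fun z hz => hz.1
  have hB : AnalyticOnNhd ℂ (complexMGF id ν) {z | z.re ∈ U} :=
    analyticOnNhd_complexMGF.mono fun z hz => hz.2
  have h0 : (0 : ℂ) ∈ {z : ℂ | z.re ∈ U} := ⟨by simpa using hμ, by simpa using hν⟩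
  have hder : ∀ n, iteratedDeriv n (complexMGF id μ) 0 = iteratedDeriv n (complexMGF id ν) 0 := by
    intro n
    rw [iteratedDeriv_complexMGF (by simpa using hμ), iteratedDeriv_complexMGF (by simpa using hν)]
    simp only [zero_mul, Complex.exp_zero, mul_one, id_eq, ← Complex.ofReal_pow]
    rw [integral_complex_ofReal, integral_complex_ofReal, h]
  -- The Taylor series at 0 agree, so the identity theorem propagates equality over the whole strip;
  -- the imaginary axis lies in it and carries the characteristic functions.
  have hs := (hA 0 h0).hasFPowerSeriesAt.sub (hB 0 h0).hasFPowerSeriesAt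
  simp only [hder, sub_self] at hs
  have hev : complexMGF id μ =ᶠ[nhds 0] complexMGF id ν := by
    filter_upwards [hs.eventually_eq_zero] with z hz
    exact sub_eq_zero.1 hz
  have heq := hA.eqOn_of_preconnected_of_eventuallyEq hB hpre h0 hev
  refine Measure.ext_of_charFun ?_
  ext t
  rw [← complexMGF_id_mul_I, ← complexMGF_id_mul_I]
  exact heq ⟨by simpa using hμ, by simpa using hν⟩

/-- A function all of whose moments vanish, and which has exponential moments, vanishes. -/
theorem ae_eq_zero_of_moments {m : Measure ℝ} {h : ℝ → ℝ} {r : ℝ} (hr : 0 < r)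
    (hint : ∀ t, |t| < r → Integrable (fun x => Real.exp (t * x) * h x) m)
    (hmom : ∀ n : ℕ, Integrable (fun x => x ^ n * h x) m)
    (hzero : ∀ n : ℕ, ∫ x, x ^ n * h x ∂m = 0) : h =ᵐ[m] 0 := by
  have hi : Integrable h m := by simpa using hmom 0
  have hmeas := hi.aemeasurable
  -- The positive and negative parts of h are taken as densities of two finite measures. Their
  -- moments differ by ∫ xⁿ h = 0, so the measures agree; since at each point one of the two
  -- densities vanishes, both do almost everywhere.
  have hp : AEMeasurable (fun x => ENNReal.ofReal (h x)) m := hmeas.ennreal_ofReal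
  have hn : AEMeasurable (fun x => ENNReal.ofReal (-h x)) m := hmeas.neg.ennreal_ofReal
  have : IsFiniteMeasure (m.withDensity fun x => ENNReal.ofReal (h x)) :=
    isFiniteMeasure_withDensity_ofReal hi.2
  have : IsFiniteMeasure (m.withDensity fun x => ENNReal.ofReal (-h x)) :=
    isFiniteMeasure_withDensity_ofReal hi.neg.2
  have hmax : ∀ w : ℝ → ℝ, AEStronglyMeasurable w m → Integrable (fun x => w x * h x) m →
      Integrable (fun x => (ENNReal.ofReal (h x)).toReal • w x) m := by
    intro w hw hwi
    refine hwi.mono (hp.ennreal_toReal.aestronglyMeasurable.smul hw) (ae_of_all _ fun x => ?_)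
    rw [norm_smul, norm_mul, mul_comm]
    gcongr
    rw [ENNReal.toReal_ofReal']
    simp only [Real.norm_eq_abs]
    exact abs_le.2 ⟨(neg_nonpos.2 (abs_nonneg _)).trans (le_max_right _ _),
      max_le (le_abs_self _) (abs_nonneg _)⟩
  have hmax' : ∀ w : ℝ → ℝ, AEStronglyMeasurable w m → Integrable (fun x => w x * h x) m →
      Integrable (fun x => (ENNReal.ofReal (-h x)).toReal • w x) m := by
    intro w hw hwi
    refine hwi.mono (hn.ennreal_toReal.aestronglyMeasurable.smul hw) (ae_of_all _ fun x => ?_)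
    rw [norm_smul, norm_mul, mul_comm]
    gcongr
    rw [ENNReal.toReal_ofReal']
    simp only [Real.norm_eq_abs]
    exact abs_le.2 ⟨(neg_nonpos.2 (abs_nonneg _)).trans (le_max_right _ _),
      max_le (neg_le_abs _) (abs_nonneg _)⟩
  have hE : ∀ (q : ℝ → ℝ≥0∞), AEMeasurable q m → (∀ x, q x ≠ ⊤) →
      (∀ w : ℝ → ℝ, AEStronglyMeasurable w m → Integrable (fun x => w x * h x) m →
        Integrable (fun x => (q x).toReal • w x) m) →
      (0 : ℝ) ∈ interior (integrableExpSet id (m.withDensity q)) := by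
    intro q hq hqt hqi
    refine mem_interior.2 ⟨Metric.ball 0 r, fun t ht => ?_, Metric.isOpen_ball,
      Metric.mem_ball_self hr⟩
    have ht' : |t| < r := by simpa using ht
    change Integrable _ _
    rw [integrable_withDensity_iff_integrable_smul₀' hq (ae_of_all _ fun x => (hqt x).lt_top)]
    exact hqi _ (by fun_prop) (hint t ht')
  have heq : (m.withDensity fun x => ENNReal.ofReal (h x)) =
      m.withDensity fun x => ENNReal.ofReal (-h x) := by
    refine measure_ext_of_moments (hE _ hp (fun x => ENNReal.ofReal_ne_top) hmax)
      (hE _ hn (fun x => ENNReal.ofReal_ne_top) hmax') fun n => ?_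
    rw [integral_withDensity_eq_integral_toReal_smul₀ hp (ae_of_all _ fun x => by simp),
      integral_withDensity_eq_integral_toReal_smul₀ hn (ae_of_all _ fun x => by simp),
      ← sub_eq_zero, ← integral_sub (hmax _ (by fun_prop) (hmom n)) (hmax' _ (by fun_prop) (hmom n)),
      ← hzero n]
    congr 1
    ext x
    rw [ENNReal.toReal_ofReal', ENNReal.toReal_ofReal', smul_eq_mul, smul_eq_mul, ← sub_mul,
      max_zero_sub_max_neg_zero_eq_self, mul_comm]
  have hae := (withDensity_eq_iff hp hn hi.lintegral_lt_top.ne).1 heq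
  filter_upwards [hae] with x hx
  rcases le_total 0 (h x) with h0 | h0
  · rw [ENNReal.ofReal_of_nonpos (neg_nonpos.2 h0)] at hx
    exact le_antisymm (ENNReal.ofReal_eq_zero.1 hx) h0
  · rw [ENNReal.ofReal_of_nonpos h0] at hx
    exact le_antisymm h0 (neg_nonpos.1 (ENNReal.ofReal_eq_zero.1 hx.symm))

/-! ### Orthonormality of the Laguerre functions. -/

theorem integrable_pow_mul_exp_neg (n : ℕ) :
    Integrable (fun t : ℝ => t ^ n * Real.exp (-t)) halfLine := by
  have h := Real.GammaIntegral_convergent (s := n + 1) (by positivity)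
  refine h.congr (ae_of_all _ fun x => ?_)
  simp [mul_comm]

theorem integral_pow_mul_exp_neg (n : ℕ) :
    ∫ t, t ^ n * Real.exp (-t) ∂halfLine = n.factorial := by
  rw [← Real.Gamma_nat_eq_factorial, Real.Gamma_eq_integral (by positivity)]
  refine integral_congr_ae (ae_of_all _ fun x => ?_)
  simp [mul_comm]

theorem exp_half_mul_exp_half (t : ℝ) : Real.exp (-t / 2) * Real.exp (-t / 2) = Real.exp (-t) := by
  rw [← Real.exp_add]; ring_nf

theorem memLp_pow_mul_exp (n : ℕ) :
    MemLp (fun t : ℝ => t ^ n * Real.exp (-t / 2)) 2 halfLine := by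
  rw [memLp_two_iff_integrable_sq (by fun_prop)]
  refine (integrable_pow_mul_exp_neg (2 * n)).congr (ae_of_all _ fun x => ?_)
  simp only [mul_pow, ← pow_mul, sq (Real.exp _), exp_half_mul_exp_half, mul_comm]

theorem laguerreFun_eq_sum (l : ℕ) (t : ℝ) :
    laguerreFun l t = ∑ j ∈ Finset.range (l + 1),
      ((-1 : ℝ) ^ j * (l.choose j : ℝ) / (j.factorial : ℝ)) * (t ^ j * Real.exp (-t / 2)) := by
  rw [laguerreFun, laguerrePoly, Finset.mul_sum]
  exact Finset.sum_congr rfl fun j _ => by ring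

theorem memLp_laguerreFun (l : ℕ) : MemLp (laguerreFun l) 2 halfLine := by
  have : laguerreFun l = fun t => ∑ j ∈ Finset.range (l + 1),
      ((-1 : ℝ) ^ j * (l.choose j : ℝ) / (j.factorial : ℝ)) * (t ^ j * Real.exp (-t / 2)) :=
    funext (laguerreFun_eq_sum l)
  rw [this]
  exact memLp_finsetSum _ fun j _ => (memLp_pow_mul_exp j).const_mul _

/-- The quotient (j+m)!/j! is a monic polynomial of degree m in j, an ascending Pochhammer symbol.
Up to the sign (−1)^l the sum is its l-th finite difference, which vanishes for m < l and equals l!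
for m = l. -/
theorem sum_alternating_choose_factorial (l m : ℕ) (hm : m ≤ l) :
    ∑ j ∈ Finset.range (l + 1), (-1 : ℝ) ^ j * (l.choose j : ℝ) / (j.factorial : ℝ) *
      ((j + m).factorial : ℝ) = if m = l then (-1) ^ l * (l.factorial : ℝ) else 0 := by
  have hP := fwdDiff_iter_eq_sum_shift (1 : ℝ) (ascPochhammer ℝ m).eval l 1
  have hterm : ∀ j ∈ Finset.range (l + 1), (-1 : ℝ) ^ j * (l.choose j : ℝ) / (j.factorial : ℝ) *
      ((j + m).factorial : ℝ) = (-1) ^ l * (((-1 : ℤ) ^ (l - j) * (l.choose j : ℤ)) •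
        (ascPochhammer ℝ m).eval (1 + j • (1 : ℝ))) := by
    intro j hj
    have hj' : j ≤ l := Nat.lt_succ_iff.1 (Finset.mem_range.1 hj)
    have h1 : (ascPochhammer ℝ m).eval (1 + j • (1 : ℝ)) = ((j + 1).ascFactorial m : ℝ) := by
      rw [← ascPochhammer_nat_eq_ascFactorial, ascPochhammer_eval_cast]
      congr 1
      push_cast; simp [add_comm]
    have h2 : ((j + m).factorial : ℝ) = (j.factorial : ℝ) * ((j + 1).ascFactorial m : ℝ) := by
      rw [← Nat.factorial_mul_ascFactorial]; push_cast; rfl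
    have h3 : (-1 : ℝ) ^ l * (-1) ^ (l - j) = (-1) ^ j := by
      obtain ⟨k, rfl⟩ := Nat.exists_eq_add_of_le hj'
      rw [Nat.add_sub_cancel_left, pow_add, mul_assoc, ← pow_add, ← two_mul, pow_mul]
      simp
    have hf : (j.factorial : ℝ) ≠ 0 := by positivity
    rw [h1, h2, ← h3, zsmul_eq_mul]
    push_cast
    field_simp
  rw [Finset.sum_congr rfl hterm, ← Finset.mul_sum, ← hP]
  split_ifs with h
  · subst h
    have := Polynomial.fwdDiff_iter_degree_eq_factorial (ascPochhammer ℝ m)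
    rw [ascPochhammer_natDegree, (monic_ascPochhammer ℝ m).leadingCoeff] at this
    rw [this]
    simp
  · rw [Polynomial.fwdDiff_iter_eq_zero_of_degree_lt
      (by rw [ascPochhammer_natDegree]; omega)]
    simp

theorem integral_pow_mul_laguerreFun (l m : ℕ) (hm : m ≤ l) :
    ∫ t, (t ^ m * Real.exp (-t / 2)) * laguerreFun l t ∂halfLine =
      if m = l then (-1) ^ l * (l.factorial : ℝ) else 0 := by
  rw [← sum_alternating_choose_factorial l m hm]
  have : ∀ t, (t ^ m * Real.exp (-t / 2)) * laguerreFun l t = ∑ j ∈ Finset.range (l + 1),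
      ((-1 : ℝ) ^ j * (l.choose j : ℝ) / (j.factorial : ℝ)) * (t ^ (j + m) * Real.exp (-t)) := by
    intro t
    rw [laguerreFun_eq_sum, Finset.mul_sum]
    refine Finset.sum_congr rfl fun j _ => ?_
    rw [← exp_half_mul_exp_half, pow_add]
    ring
  simp_rw [this]
  rw [integral_finsetSum _ fun j _ => (integrable_pow_mul_exp_neg _).const_mul _]
  simp_rw [integral_const_mul, integral_pow_mul_exp_neg]

/-- Only the leading term of φ_k can meet φ_l, and only if k = l; then (−1)^k/k! times (−1)^k k! is
1. -/
theorem integral_laguerreFun_mul_of_le {k l : ℕ} (hkl : k ≤ l) :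
    ∫ t, laguerreFun k t * laguerreFun l t ∂halfLine = if k = l then 1 else 0 := by
  have : ∀ t, laguerreFun k t * laguerreFun l t = ∑ j ∈ Finset.range (k + 1),
      ((-1 : ℝ) ^ j * (k.choose j : ℝ) / (j.factorial : ℝ)) *
        ((t ^ j * Real.exp (-t / 2)) * laguerreFun l t) := by
    intro t
    rw [laguerreFun_eq_sum k, Finset.sum_mul]
    exact Finset.sum_congr rfl fun j _ => by ring
  have hi : ∀ j : ℕ, Integrable (fun t => (t ^ j * Real.exp (-t / 2)) * laguerreFun l t)
      halfLine := fun j => (memLp_pow_mul_exp j).integrable_mul (memLp_laguerreFun l)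
  simp_rw [this]
  rw [integral_finsetSum _ fun j _ => (hi j).const_mul _]
  simp_rw [integral_const_mul]
  rw [Finset.sum_congr rfl fun j hj => by
    rw [integral_pow_mul_laguerreFun l j ((Nat.lt_succ_iff.1 (Finset.mem_range.1 hj)).trans hkl)]]
  split_ifs with h
  · subst h
    rw [Finset.sum_range_succ, Finset.sum_eq_zero fun j hj => ?_]
    · have : (k.factorial : ℝ) ≠ 0 := by positivity
      simp only [Nat.choose_self, Nat.cast_one, mul_one, if_true, zero_add]
      field_simp
      rw [← pow_mul, mul_comm, pow_mul]; simp
    · rw [if_neg (Finset.mem_range.1 hj).ne, mul_zero]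
  · refine Finset.sum_eq_zero fun j hj => ?_
    rw [if_neg (by have := Finset.mem_range.1 hj; omega), mul_zero]

theorem integral_laguerreFun_mul (k l : ℕ) :
    ∫ t, laguerreFun k t * laguerreFun l t ∂halfLine = if k = l then 1 else 0 := by
  rcases le_total k l with h | h
  · exact integral_laguerreFun_mul_of_le h
  · simp_rw [mul_comm (laguerreFun k _)]
    rw [integral_laguerreFun_mul_of_le h]
    simp [eq_comm]

/-! ### Completeness of the Laguerre functions and Parseval's identity. -/

/-- The passage from the functions t^j e^(−t/2) to the φ_n is triangular with diagonal (−1)^n/n! ≠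
0, so it can be inverted by induction. -/
theorem integral_mul_pow_eq_zero {f : ℝ → ℝ} (hf : MemLp f 2 halfLine)
    (h : ∀ l, coeff f l = 0) (n : ℕ) :
    ∫ t, f t * (t ^ n * Real.exp (-t / 2)) ∂halfLine = 0 := by
  induction n using Nat.strong_induction_on with
  | _ n ih =>
    have h1 := h n
    rw [coeff] at h1
    have : ∀ t, f t * laguerreFun n t = ∑ j ∈ Finset.range (n + 1),
        ((-1 : ℝ) ^ j * (n.choose j : ℝ) / (j.factorial : ℝ)) *
          (f t * (t ^ j * Real.exp (-t / 2))) := by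
      intro t
      rw [laguerreFun_eq_sum n, Finset.mul_sum]
      exact Finset.sum_congr rfl fun j _ => by ring
    have hi : ∀ j : ℕ, Integrable (fun t => f t * (t ^ j * Real.exp (-t / 2))) halfLine :=
      fun j => hf.integrable_mul (memLp_pow_mul_exp j)
    simp_rw [this] at h1
    rw [integral_finsetSum _ fun j _ => (hi j).const_mul _] at h1
    simp_rw [integral_const_mul] at h1
    rw [Finset.sum_range_succ, Finset.sum_eq_zero fun j hj => by
      rw [ih j (Finset.mem_range.1 hj), mul_zero], zero_add] at h1
    refine (mul_eq_zero.1 h1).resolve_left ?_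
    have : (n.factorial : ℝ) ≠ 0 := by positivity
    simp [this]

theorem ae_eq_zero_of_coeff_eq_zero {f : ℝ → ℝ} (hf : MemLp f 2 halfLine)
    (h : ∀ l, coeff f l = 0) : f =ᵐ[halfLine] 0 := by
  have hz : (fun t => f t * Real.exp (-t / 2)) =ᵐ[halfLine] 0 := by
    refine ae_eq_zero_of_moments (r := 1 / 4) (by norm_num) (fun t ht => ?_) (fun n => ?_)
      fun n => ?_
    -- The square of this function is e^(−(1−2t)x), integrable for t < 1/2; the radius 1/4 leaves
    -- room.
    · have hm : MemLp (fun x : ℝ => Real.exp (t * x) * Real.exp (-x / 2)) 2 halfLine := by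
        rw [memLp_two_iff_integrable_sq (by fun_prop)]
        have := integrableOn_rpow_mul_exp_neg_mul_rpow (p := 1) (s := 0) (b := 1 - 2 * t)
          (by norm_num) (by norm_num) (by have := (abs_lt.1 ht).2; linarith)
        refine this.congr (ae_of_all _ fun x => ?_)
        simp only [Real.rpow_zero, one_mul, Real.rpow_one, ← Real.exp_add, sq]
        ring_nf
      refine (hf.integrable_mul hm).congr (ae_of_all _ fun x => ?_)
      simp only [Pi.mul_apply]; ring
    · refine (hf.integrable_mul (memLp_pow_mul_exp n)).congr (ae_of_all _ fun x => ?_)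
      simp only [Pi.mul_apply]; ring
    · rw [← integral_mul_pow_eq_zero hf h n]
      congr 1; ext x; ring
  filter_upwards [hz] with x hx
  exact (mul_eq_zero.1 hx).resolve_right (Real.exp_pos _).ne'

/-- The class of the Laguerre function `φ_l` in `L²(0, ∞)`. -/
noncomputable def laguerreLp (l : ℕ) : Lp ℝ 2 halfLine := (memLp_laguerreFun l).toLp

theorem inner_toLp_laguerreLp {f : ℝ → ℝ} (hf : MemLp f 2 halfLine) (l : ℕ) :
    inner ℝ (hf.toLp) (laguerreLp l) = coeff f l := by
  rw [L2.inner_def, coeff]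
  refine integral_congr_ae ?_
  filter_upwards [hf.coeFn_toLp, (memLp_laguerreFun l).coeFn_toLp] with x hx hy
  rw [laguerreLp, hx, hy]
  simp [mul_comm]

theorem orthonormal_laguerreLp : Orthonormal ℝ laguerreLp := by
  rw [orthonormal_iff_ite]
  intro i j
  rw [laguerreLp, inner_toLp_laguerreLp, coeff, integral_laguerreFun_mul]

/-- The Laguerre functions form a Hilbert basis of `L²(0, ∞)`. -/
noncomputable def laguerreBasis : HilbertBasis ℕ ℝ (Lp ℝ 2 halfLine) :=
  HilbertBasis.mkOfOrthogonalEqBot orthonormal_laguerreLp <| by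
    rw [Submodule.eq_bot_iff]
    intro f hf
    rw [Submodule.mem_orthogonal'] at hf
    have h0 : ∀ l, coeff f l = 0 := fun l => by
      rw [← inner_toLp_laguerreLp (Lp.memLp f), Lp.toLp_coeFn]
      exact hf _ (Submodule.subset_span ⟨l, rfl⟩)
    exact (Lp.eq_zero_iff_ae_eq_zero).2 (ae_eq_zero_of_coeff_eq_zero (Lp.memLp f) h0)

/-- **Parseval's identity** for the Laguerre functions. -/
theorem hasSum_sq_coeff {f : ℝ → ℝ} (hf : MemLp f 2 halfLine) :
    HasSum (fun l => coeff f l ^ 2) ((eLpNorm f 2 halfLine).toReal ^ 2) := by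
  have h := laguerreBasis.hasSum_inner_mul_inner hf.toLp hf.toLp
  rw [real_inner_self_eq_norm_sq, Lp.norm_toLp] at h
  refine h.congr_fun fun l => ?_
  rw [laguerreBasis, HilbertBasis.coe_mkOfOrthogonalEqBot, real_inner_comm _ (laguerreLp l),
    inner_toLp_laguerreLp, sq]

theorem coeff_sum_sub {f : ℝ → ℝ} (hf : MemLp f 2 halfLine) (s : Finset ℕ) (a : ℕ → ℝ) (l : ℕ) :
    coeff (fun x => ∑ k ∈ s, a k * laguerreFun k x - f x) l =
      (if l ∈ s then a l else 0) - coeff f l := by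
  have hi : ∀ k, Integrable (fun x => laguerreFun k x * laguerreFun l x) halfLine := fun k =>
    (memLp_laguerreFun k).integrable_mul (memLp_laguerreFun l)
  have hfi : Integrable (fun x => f x * laguerreFun l x) halfLine :=
    hf.integrable_mul (memLp_laguerreFun l)
  simp only [coeff, sub_mul, Finset.sum_mul, mul_assoc]
  rw [integral_sub (integrable_finsetSum _ fun k _ => (hi k).const_mul _) hfi,
    integral_finsetSum _ fun k _ => (hi k).const_mul _]
  simp_rw [integral_const_mul, integral_laguerreFun_mul]
  simp

/-- If the coefficient errors of a finite Laguerre expansion are dominated by a square summable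
sequence, then so is its `L²` error. -/
theorem eLpNorm_sum_sub_le {f : ℝ → ℝ} (hf : MemLp f 2 halfLine) (s : Finset ℕ) (a : ℕ → ℝ)
    {d : ℕ → ℝ} {D : ℝ} (hd : HasSum d D)
    (h : ∀ l, ((if l ∈ s then a l else 0) - coeff f l) ^ 2 ≤ d l) :
    eLpNorm (fun x => ∑ k ∈ s, a k * laguerreFun k x - f x) 2 halfLine ≤
      ENNReal.ofReal (Real.sqrt D) := by
  have hm : MemLp (fun x => ∑ k ∈ s, a k * laguerreFun k x - f x) 2 halfLine :=
    (memLp_finsetSum _ fun k _ => (memLp_laguerreFun k).const_mul _).sub hf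
  have hs := hasSum_sq_coeff hm
  simp only [coeff_sum_sub hf] at hs
  rw [← ENNReal.ofReal_toReal hm.eLpNorm_ne_top]
  exact ENNReal.ofReal_le_ofReal (Real.le_sqrt_of_sq_le (hasSum_le h hs hd))

/-! ### The spectral norm of a Toeplitz matrix -/

theorem opNorm_nonneg {m : ℕ} (A : Matrix (Fin m) (Fin m) ℝ) : 0 ≤ opNorm A := norm_nonneg _

theorem norm_toLp_mulVec_le {m : ℕ} (A : Matrix (Fin m) (Fin m) ℝ) (v : Fin m → ℝ) :
    ‖WithLp.toLp 2 (A.mulVec v)‖ ≤ opNorm A * ‖WithLp.toLp 2 v‖ := by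
  rw [← Matrix.toEuclideanCLM_toLp]
  exact ContinuousLinearMap.le_opNorm _ _

theorem opNorm_mul_le {m : ℕ} (A B : Matrix (Fin m) (Fin m) ℝ) :
    opNorm (A * B) ≤ opNorm A * opNorm B := by
  rw [opNorm, map_mul]
  exact norm_mul_le _ _

/-- Testing with u = Av gives ‖Av‖² ≤ X‖Av‖‖v‖. -/
theorem opNorm_le_of_bilinear {m : ℕ} {A : Matrix (Fin m) (Fin m) ℝ} {X : ℝ} (hX : 0 ≤ X)
    (h : ∀ u v : Fin m → ℝ, |u ⬝ᵥ A.mulVec v| ≤ X * ‖WithLp.toLp 2 u‖ * ‖WithLp.toLp 2 v‖) :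
    opNorm A ≤ X := by
  refine ContinuousLinearMap.opNorm_le_bound _ hX fun v => ?_
  have h1 := h (A.mulVec v.ofLp) v.ofLp
  have h2 : (A.mulVec v.ofLp) ⬝ᵥ (A.mulVec v.ofLp) = ‖Matrix.toEuclideanCLM (𝕜 := ℝ) A v‖ ^ 2 := by
    rw [← real_inner_self_eq_norm_sq, Matrix.inner_toEuclideanCLM]
    rfl
  rw [h2, abs_of_nonneg (sq_nonneg _), ← Matrix.toEuclideanCLM_toLp] at h1
  rcases (norm_nonneg (Matrix.toEuclideanCLM (𝕜 := ℝ) A v)).eq_or_lt with h0 | h0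
  · rw [← h0]; positivity
  · refine le_of_mul_le_mul_left ?_ h0
    calc _ = ‖Matrix.toEuclideanCLM (𝕜 := ℝ) A v‖ ^ 2 := (sq _).symm
      _ ≤ _ := h1
      _ = _ := by simp only [WithLp.toLp_ofLp]; ring

theorem abs_apply_le_norm_toLp {m : ℕ} (v : Fin m → ℝ) (i : Fin m) :
    |v i| ≤ ‖WithLp.toLp 2 v‖ := by
  have := PiLp.norm_apply_le (WithLp.toLp 2 v) i
  simpa using this

/-- Applied to its own i-th row, A has i-th coordinate equal to the squared norm of that row. -/
theorem norm_toLp_row_le {m : ℕ} (A : Matrix (Fin m) (Fin m) ℝ) (i : Fin m) :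
    ‖WithLp.toLp 2 (A i)‖ ≤ opNorm A := by
  have h := abs_apply_le_norm_toLp (A.mulVec (A i)) i
  have h1 : A.mulVec (A i) i = ‖WithLp.toLp 2 (A i)‖ ^ 2 := by
    rw [EuclideanSpace.norm_sq_eq, Matrix.mulVec, dotProduct]
    exact Finset.sum_congr rfl fun j _ => by simp [sq]
  have h2 := norm_toLp_mulVec_le A (A i)
  rw [h1, abs_of_nonneg (sq_nonneg _)] at h
  rcases (norm_nonneg (WithLp.toLp 2 (A i))).eq_or_lt with h0 | h0
  · rw [← h0]; exact opNorm_nonneg A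
  · refine le_of_mul_le_mul_right ?_ h0
    calc _ = _ := (sq _).symm
      _ ≤ _ := h.trans h2

/-- The symbol `∑_{k ≤ l} b_k ω^{rk}` at the root of unity of index `r`. -/
noncomputable def toeplitzSymbol (l : ℕ) (b : ℕ → ℝ) (r : ZMod (2 * l + 2)) : ℂ :=
  ∑ k : Fin (l + 1), (b k : ℂ) * ZMod.stdAddChar (r * ((k : ℕ) : ZMod (2 * l + 2)))

/-- Parseval on ℤ/(2l+2): the indices 0, …, l stay distinct modulo 2l+2, so only diagonal terms
survive. -/
theorem sum_norm_sq_char (l : ℕ) (v : Fin (l + 1) → ℝ) :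
    ∑ r : ZMod (2 * l + 2), ‖∑ k : Fin (l + 1), (v k : ℂ) *
      ZMod.stdAddChar (r * ((k : ℕ) : ZMod (2 * l + 2)))‖ ^ 2 =
      (2 * l + 2) * ‖WithLp.toLp 2 v‖ ^ 2 := by
  have key : ∀ i j : Fin (l + 1), (((i : ℕ) : ZMod (2 * l + 2)) - ((j : ℕ) : ZMod (2 * l + 2)) = 0)
      ↔ i = j := by
    intro i j
    rw [sub_eq_zero, ZMod.natCast_eq_natCast_iff', Nat.mod_eq_of_lt (by omega),
      Nat.mod_eq_of_lt (by omega), Fin.ext_iff]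
  have hc : ∀ r : ZMod (2 * l + 2), ((‖∑ k : Fin (l + 1), (v k : ℂ) *
      ZMod.stdAddChar (r * ((k : ℕ) : ZMod (2 * l + 2)))‖ ^ 2 : ℝ) : ℂ) =
      ∑ i : Fin (l + 1), ∑ j : Fin (l + 1), (v i : ℂ) * (v j : ℂ) *
        ZMod.stdAddChar (r * (((i : ℕ) : ZMod (2 * l + 2)) - ((j : ℕ) : ZMod (2 * l + 2)))) := by
    intro r
    rw [← Complex.normSq_eq_norm_sq, ← Complex.mul_conj, map_sum, Finset.sum_mul_sum]
    refine Finset.sum_congr rfl fun i _ => Finset.sum_congr rfl fun j _ => ?_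
    rw [map_mul (starRingEnd ℂ), Complex.conj_ofReal, ← AddChar.map_neg_eq_conj, mul_sub, sub_eq_add_neg,
      AddChar.map_add_eq_mul]
    ring
  apply Complex.ofReal_injective
  rw [Complex.ofReal_sum, Finset.sum_congr rfl fun r _ => hc r, Finset.sum_comm]
  simp_rw [Finset.sum_comm (s := Finset.univ (α := ZMod (2 * l + 2))), ← Finset.mul_sum,
    AddChar.sum_mulShift _ (ZMod.isPrimitive_stdAddChar _), key]
  rw [EuclideanSpace.norm_sq_eq]
  simp only [Nat.cast_ite, ZMod.card, Nat.cast_zero, mul_ite, mul_zero, Finset.sum_ite_eq,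
    Finset.mem_univ, if_true, Real.norm_eq_abs, sq_abs]
  push_cast
  rw [Finset.mul_sum]
  exact Finset.sum_congr rfl fun i _ => by ring

/-- The Toeplitz form is diagonalised by embedding it in a cyclic convolution. Since k + j ≤ 2l < 2l
+ 2, a congruence k + j ≡ i is an equality, and nothing wraps around. -/
theorem sum_symbol_mul_char (l : ℕ) (b : ℕ → ℝ) (u v : Fin (l + 1) → ℝ) :
    ∑ r : ZMod (2 * l + 2), toeplitzSymbol l b r *
      ((∑ j : Fin (l + 1), (v j : ℂ) * ZMod.stdAddChar (r * ((j : ℕ) : ZMod (2 * l + 2)))) *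
      (starRingEnd ℂ) (∑ i : Fin (l + 1), (u i : ℂ) *
        ZMod.stdAddChar (r * ((i : ℕ) : ZMod (2 * l + 2))))) =
      (2 * l + 2) * ((u ⬝ᵥ (toeplitz b l).mulVec v : ℝ) : ℂ) := by
  have key : ∀ k j i : Fin (l + 1), (((k : ℕ) : ZMod (2 * l + 2)) +
      (((j : ℕ) : ZMod (2 * l + 2)) - ((i : ℕ) : ZMod (2 * l + 2))) = 0)
      ↔ (k : ℕ) + j = i := by
    intro i j k
    rw [← add_sub_assoc, sub_eq_zero, ← Nat.cast_add, ZMod.natCast_eq_natCast_iff',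
      Nat.mod_eq_of_lt (by omega), Nat.mod_eq_of_lt (by omega)]
  have hc : ∀ r : ZMod (2 * l + 2), toeplitzSymbol l b r *
      ((∑ j : Fin (l + 1), (v j : ℂ) * ZMod.stdAddChar (r * ((j : ℕ) : ZMod (2 * l + 2)))) *
      (starRingEnd ℂ) (∑ i : Fin (l + 1), (u i : ℂ) *
        ZMod.stdAddChar (r * ((i : ℕ) : ZMod (2 * l + 2))))) =
      ∑ k : Fin (l + 1), ∑ j : Fin (l + 1), ∑ i : Fin (l + 1),
        ((b k : ℂ) * (v j : ℂ) * (u i : ℂ)) * ZMod.stdAddChar (r * (((k : ℕ) : ZMod (2 * l + 2)) +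
          (((j : ℕ) : ZMod (2 * l + 2)) - ((i : ℕ) : ZMod (2 * l + 2))))) := by
    intro r
    rw [toeplitzSymbol, map_sum, Finset.sum_mul_sum, Finset.sum_mul]
    refine Finset.sum_congr rfl fun k _ => ?_
    rw [Finset.mul_sum]
    refine Finset.sum_congr rfl fun j _ => ?_
    rw [Finset.mul_sum]
    refine Finset.sum_congr rfl fun i _ => ?_
    rw [map_mul (starRingEnd ℂ), Complex.conj_ofReal, ← AddChar.map_neg_eq_conj, mul_add, mul_sub,
      sub_eq_add_neg, AddChar.map_add_eq_mul, AddChar.map_add_eq_mul]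
    ring
  have hinner : ∀ i j : Fin (l + 1), (∑ k : Fin (l + 1),
      if (k : ℕ) + j = i then b k else 0) = toeplitz b l i j := by
    intro i j
    simp only [toeplitz, Matrix.of_apply]
    split_ifs with hij
    · rw [Finset.sum_eq_single ⟨(i : ℕ) - j, by omega⟩]
      · rw [if_pos (by simp only []; omega)]
      · intro k _ hk
        rw [if_neg fun h => hk (Fin.ext (by simp only []; omega))]
      · simp
    · exact Finset.sum_eq_zero fun k _ => if_neg (by omega)
  calc _ = ∑ k : Fin (l + 1), ∑ j : Fin (l + 1), ∑ i : Fin (l + 1),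
        ((b k : ℂ) * (v j : ℂ) * (u i : ℂ)) * (if (k : ℕ) + j = i then ((2 * l + 2 : ℕ) : ℂ) else 0) := by
        rw [Finset.sum_congr rfl fun r _ => hc r, Finset.sum_comm]
        refine Finset.sum_congr rfl fun k _ => ?_
        rw [Finset.sum_comm]
        refine Finset.sum_congr rfl fun j _ => ?_
        rw [Finset.sum_comm]
        refine Finset.sum_congr rfl fun i _ => ?_
        rw [← Finset.mul_sum, AddChar.sum_mulShift _ (ZMod.isPrimitive_stdAddChar _)]
        simp only [key, ZMod.card, Nat.cast_ite, Nat.cast_zero]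
    _ = (2 * l + 2) * ∑ i : Fin (l + 1), ∑ j : Fin (l + 1), (u i : ℂ) * ((∑ k : Fin (l + 1),
          if (k : ℕ) + j = i then b k else 0 : ℝ) : ℂ) * (v j : ℂ) := by
        rw [Finset.mul_sum, Finset.sum_congr rfl fun k _ => Finset.sum_comm, Finset.sum_comm]
        refine Finset.sum_congr rfl fun i _ => ?_
        rw [Finset.mul_sum, Finset.sum_comm]
        refine Finset.sum_congr rfl fun j _ => ?_
        push_cast
        rw [Finset.mul_sum, Finset.sum_mul, Finset.mul_sum]
        refine Finset.sum_congr rfl fun k _ => ?_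
        split_ifs <;> push_cast <;> ring
    _ = _ := by
        simp_rw [hinner, dotProduct, Matrix.mulVec, dotProduct]
        push_cast
        congr 1
        refine Finset.sum_congr rfl fun i _ => ?_
        rw [Finset.mul_sum]
        exact Finset.sum_congr rfl fun j _ => by ring

/-- The spectral norm of a Toeplitz matrix is at most the maximum of its symbol. -/
theorem opNorm_toeplitz_le (l : ℕ) (b : ℕ → ℝ) {X : ℝ} (h : ∀ r, ‖toeplitzSymbol l b r‖ ≤ X) :
    opNorm (toeplitz b l) ≤ X := by
  have hX : 0 ≤ X := (norm_nonneg _).trans (h 0)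
  refine opNorm_le_of_bilinear hX fun u v => ?_
  have hN : (0 : ℝ) < 2 * l + 2 := by positivity
  refine le_of_mul_le_mul_left ?_ hN
  have h1 := congrArg (‖·‖) (sum_symbol_mul_char l b u v)
  simp only [norm_mul, Complex.norm_real, Real.norm_eq_abs] at h1
  have h2 : ‖(2 * l + 2 : ℂ)‖ = 2 * l + 2 := by
    have : (2 * l + 2 : ℂ) = ((2 * l + 2 : ℝ) : ℂ) := by push_cast; rfl
    rw [this, Complex.norm_real, Real.norm_eq_abs, abs_of_pos hN]
  rw [h2] at h1
  rw [← h1]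
  refine (norm_sum_le _ _).trans ?_
  -- Cauchy–Schwarz in r, then Parseval for u and v; the factor 2l+2 cancels.
  calc _ ≤ ∑ r : ZMod (2 * l + 2), X *
        (‖∑ j : Fin (l + 1), (v j : ℂ) * ZMod.stdAddChar (r * ((j : ℕ) : ZMod (2 * l + 2)))‖ *
        ‖∑ i : Fin (l + 1), (u i : ℂ) * ZMod.stdAddChar (r * ((i : ℕ) : ZMod (2 * l + 2)))‖) := by
        refine Finset.sum_le_sum fun r _ => ?_
        rw [norm_mul, norm_mul, RCLike.norm_conj]
        gcongr
        exact h r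
    _ ≤ X * (√((2 * l + 2) * ‖WithLp.toLp 2 v‖ ^ 2) * √((2 * l + 2) * ‖WithLp.toLp 2 u‖ ^ 2)) := by
        rw [← Finset.mul_sum, ← sum_norm_sq_char, ← sum_norm_sq_char]
        gcongr
        exact Real.sum_mul_le_sqrt_mul_sqrt _ _ _
    _ = _ := by
        rw [← Real.sqrt_mul (by positivity), show (2 * l + 2 : ℝ) * ‖WithLp.toLp 2 v‖ ^ 2 *
          ((2 * l + 2) * ‖WithLp.toLp 2 u‖ ^ 2) =
          ((2 * l + 2) * ‖WithLp.toLp 2 v‖ * ‖WithLp.toLp 2 u‖) ^ 2 by ring,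
          Real.sqrt_sq (by positivity)]
        ring

/-! ### Sub-Gaussian estimates -/

section SubGaussian

variable {Ω : Type*} [MeasurableSpace Ω] {P : Measure Ω} {X : Ω → ℝ} {c : NNReal}

theorem hasSubgaussianMGF_mono {c' : NNReal} (h : HasSubgaussianMGF X c P) (hc : c ≤ c') :
    HasSubgaussianMGF X c' P where
  integrable_exp_mul := h.integrable_exp_mul
  mgf_le t := (h.mgf_le t).trans <| by gcongr

theorem hasSubgaussianMGF_of_map_eq {v : NNReal} (h : P.map X = gaussianReal 0 v)
    (hX : AEMeasurable X P) : HasSubgaussianMGF X v P where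
  integrable_exp_mul t := by
    have := integrable_exp_mul_gaussianReal (μ := 0) (v := v) t
    rw [← h] at this
    exact this.comp_aemeasurable hX
  mgf_le t := by
    rw [mgf_gaussianReal h]
    simp

theorem lintegral_exp_mul_abs_le (h : HasSubgaussianMGF X c P) (u : ℝ) :
    ∫⁻ ω, ENNReal.ofReal (Real.exp (u * |X ω|)) ∂P ≤
      ENNReal.ofReal (2 * Real.exp (c * u ^ 2 / 2)) := by
  have hb : ∀ t : ℝ, ∫⁻ ω, ENNReal.ofReal (Real.exp (t * X ω)) ∂P ≤
      ENNReal.ofReal (Real.exp (c * t ^ 2 / 2)) := fun t => by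
    rw [← ofReal_integral_eq_lintegral_ofReal (h.integrable_exp_mul t)
      (ae_of_all _ fun _ => (Real.exp_pos _).le)]
    exact ENNReal.ofReal_le_ofReal (h.mgf_le t)
  have hm : AEMeasurable (fun ω => ENNReal.ofReal (Real.exp (u * X ω))) P := by
    have := h.aemeasurable
    fun_prop
  calc _ ≤ ∫⁻ ω, (ENNReal.ofReal (Real.exp (u * X ω)) +
        ENNReal.ofReal (Real.exp (-u * X ω))) ∂P := by
        refine lintegral_mono fun ω => ?_
        rw [← ENNReal.ofReal_add (Real.exp_pos _).le (Real.exp_pos _).le]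
        refine ENNReal.ofReal_le_ofReal ?_
        rcases abs_choice (X ω) with h | h <;> rw [h]
        · exact le_add_of_nonneg_right (Real.exp_pos _).le
        · rw [mul_neg, neg_mul]
          exact le_add_of_nonneg_left (Real.exp_pos _).le
    _ ≤ ENNReal.ofReal (Real.exp (c * u ^ 2 / 2)) + ENNReal.ofReal (Real.exp (c * u ^ 2 / 2)) := by
        rw [lintegral_add_left' hm]
        refine add_le_add (hb u) ?_
        simpa using hb (-u)
    _ = _ := by
        rw [← ENNReal.ofReal_add (Real.exp_pos _).le (Real.exp_pos _).le, two_mul]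

theorem sq_le_two_mul_exp_abs (x : ℝ) : x ^ 2 ≤ 2 * Real.exp (1 * |x|) := by
  have := Real.quadratic_le_exp_of_nonneg (abs_nonneg x)
  rw [sq_abs] at this
  rw [one_mul]
  have := abs_nonneg x
  linarith

theorem lintegral_sq_le (h : HasSubgaussianMGF X c P) :
    ∫⁻ ω, ENNReal.ofReal (X ω ^ 2) ∂P ≤ ENNReal.ofReal (4 * Real.exp (c / 2)) := by
  calc _ ≤ ∫⁻ ω, ENNReal.ofReal 2 * ENNReal.ofReal (Real.exp (1 * |X ω|)) ∂P := by
        refine lintegral_mono fun ω => ?_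
        rw [← ENNReal.ofReal_mul two_pos.le]
        exact ENNReal.ofReal_le_ofReal (sq_le_two_mul_exp_abs _)
    _ ≤ ENNReal.ofReal 2 * ENNReal.ofReal (2 * Real.exp (c * 1 ^ 2 / 2)) := by
        rw [lintegral_const_mul' _ _ ENNReal.ofReal_ne_top]
        gcongr
        exact lintegral_exp_mul_abs_le h 1
    _ = _ := by
        rw [← ENNReal.ofReal_mul two_pos.le]
        ring_nf

theorem measure_lt_abs_le [IsFiniteMeasure P] (h : HasSubgaussianMGF X c P) {a : ℝ} (ha : 0 ≤ a) :
    P {ω | a < |X ω|} ≤ ENNReal.ofReal (2 * Real.exp (-a ^ 2 / (2 * c))) := by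
  have h1 := h.measure_ge_le ha
  have h2 := h.neg.measure_ge_le ha
  calc P {ω | a < |X ω|} ≤ P ({ω | a ≤ X ω} ∪ {ω | a ≤ (-X) ω}) := by
        refine measure_mono fun ω hω => ?_
        rcases lt_abs.1 (show a < |X ω| from hω) with h | h
        · exact Or.inl h.le
        · exact Or.inr (by simpa using h.le)
    _ ≤ P {ω | a ≤ X ω} + P {ω | a ≤ (-X) ω} := measure_union_le _ _
    _ = ENNReal.ofReal (P.real {ω | a ≤ X ω}) + ENNReal.ofReal (P.real {ω | a ≤ (-X) ω}) := by
        rw [ofReal_measureReal, ofReal_measureReal]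
    _ ≤ _ := by
        rw [← ENNReal.ofReal_add measureReal_nonneg measureReal_nonneg, two_mul]
        exact ENNReal.ofReal_le_ofReal (add_le_add h1 h2)

/-- Linear combinations of i.i.d. standard Gaussian variables are sub-Gaussian. -/
theorem hasSubgaussianMGF_sum {b : ℕ → Ω → ℝ} (hlaw : ∀ k, HasLaw (b k) (gaussianReal 0 1) P)
    (hind : iIndepFun b P) {n : ℕ} (a : Fin n → ℝ) (hc : ∑ k, a k ^ 2 ≤ c) :
    HasSubgaussianMGF (fun ω => ∑ k, a k * b k ω) c P := by
  have hi : iIndepFun (fun (k : Fin n) ω => a k * b k ω) P :=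
    (hind.precomp Fin.val_injective).comp (fun k x => a k * x) fun k => by fun_prop
  have hs := HasSubgaussianMGF.sum_of_iIndepFun (s := Finset.univ) hi
    (fun k _ => (hasSubgaussianMGF_of_map_eq (hlaw k).map_eq (hlaw k).aemeasurable).const_mul (a k))
  refine hasSubgaussianMGF_mono hs ?_
  rw [← NNReal.coe_le_coe]
  refine le_trans (le_of_eq ?_) hc
  push_cast
  exact Finset.sum_congr rfl fun k _ => mul_one _

end SubGaussian

/-- Tail bound for the spectral norm of a Gaussian Toeplitz matrix. -/
theorem measure_lt_opNorm_toeplitz_le {Ω : Type*} [MeasurableSpace Ω] {P : Measure Ω}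
    [IsProbabilityMeasure P] {b : ℕ → Ω → ℝ} (hlaw : ∀ k, HasLaw (b k) (gaussianReal 0 1) P)
    (hind : iIndepFun b P) (l : ℕ) {x : ℝ} (hx : 0 ≤ x) :
    P {ω | x < opNorm (toeplitz (fun k => b k ω) l)} ≤
      ENNReal.ofReal (8 * (l + 1) * Real.exp (-x ^ 2 / (8 * (l + 1)))) := by
  set χ : ZMod (2 * l + 2) → Fin (l + 1) → ℂ := fun r k =>
    ZMod.stdAddChar (r * ((k : ℕ) : ZMod (2 * l + 2))) with hχ
  have hn : ∀ r k, ‖χ r k‖ = 1 := fun r k => AddChar.norm_apply _ _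
  have hre : ∀ r ω, (toeplitzSymbol l (fun k => b k ω) r).re = ∑ k, (χ r k).re * b k ω := by
    intro r ω
    rw [toeplitzSymbol, Complex.re_sum]
    exact Finset.sum_congr rfl fun k _ => by rw [Complex.re_ofReal_mul, mul_comm]
  have him : ∀ r ω, (toeplitzSymbol l (fun k => b k ω) r).im = ∑ k, (χ r k).im * b k ω := by
    intro r ω
    rw [toeplitzSymbol, Complex.im_sum]
    exact Finset.sum_congr rfl fun k _ => by rw [Complex.im_ofReal_mul, mul_comm]
  -- A modulus above x forces the real or the imaginary part above x/2. Each is a linear form with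
  -- l+1 coefficients of size at most 1; the 2(2l+2) two-sided tails add up to the prefactor 8(l+1).
  have hcard : ∀ a : Fin (l + 1) → ℝ, (∀ k, |a k| ≤ 1) →
      P {ω | x / 2 < |∑ k, a k * b k ω|} ≤
        ENNReal.ofReal (2 * Real.exp (-x ^ 2 / (8 * (l + 1)))) := by
    intro a ha
    have hsub := hasSubgaussianMGF_sum (c := l + 1) hlaw hind a (by
      calc ∑ k, a k ^ 2 ≤ ∑ k : Fin (l + 1), (1 : ℝ) :=
            Finset.sum_le_sum fun k _ => (sq_le_one_iff_abs_le_one _).2 (ha k)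
        _ = _ := by simp)
    refine (measure_lt_abs_le hsub (by positivity)).trans (le_of_eq ?_)
    push_cast
    congr 3
    field_simp
    ring
  have hsub : {ω | x < opNorm (toeplitz (fun k => b k ω) l)} ⊆ ⋃ r : ZMod (2 * l + 2),
      ({ω | x / 2 < |∑ k, (χ r k).re * b k ω|} ∪ {ω | x / 2 < |∑ k, (χ r k).im * b k ω|}) := by
    intro ω hω
    by_contra hcon
    simp only [Set.mem_iUnion, Set.mem_union, Set.mem_ofPred_eq, not_exists, not_or, not_lt] at hcon
    refine absurd (opNorm_toeplitz_le l (fun k => b k ω) (X := x) fun r => ?_) (not_le.2 hω)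
    refine (Complex.norm_le_abs_re_add_abs_im _).trans ?_
    rw [hre, him]
    linarith [(hcon r).1, (hcon r).2]
  calc _ ≤ _ := measure_mono hsub
    _ ≤ ∑ r : ZMod (2 * l + 2), (P {ω | x / 2 < |∑ k, (χ r k).re * b k ω|} +
          P {ω | x / 2 < |∑ k, (χ r k).im * b k ω|}) :=
        (measure_iUnion_fintype_le _ _).trans (Finset.sum_le_sum fun r _ => measure_union_le _ _)
    _ ≤ ∑ r : ZMod (2 * l + 2), (ENNReal.ofReal (2 * Real.exp (-x ^ 2 / (8 * (l + 1)))) +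
          ENNReal.ofReal (2 * Real.exp (-x ^ 2 / (8 * (l + 1))))) := by
        refine Finset.sum_le_sum fun r _ => add_le_add (hcard _ fun k => ?_) (hcard _ fun k => ?_)
        · exact (Complex.abs_re_le_norm _).trans (hn r k).le
        · exact (Complex.abs_im_le_norm _).trans (hn r k).le
    _ = _ := by
        rw [← ENNReal.ofReal_add (by positivity) (by positivity), Finset.sum_const,
          Finset.card_univ, ZMod.card, nsmul_eq_mul, ← ENNReal.ofReal_natCast,
          ← ENNReal.ofReal_mul (by positivity)]
        congr 1
        push_cast
        ring

/-! ### The noise of the signal -/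

theorem posSemidef_designCov {n : ℕ} {T : ℝ} (hT : 0 < T) (t : Fin n → ℝ) (l : ℕ) :
    (designCov T t l).PosSemidef := by
  have h := Matrix.posSemidef_self_mul_conjTranspose (designMatrix t l)
  rw [Matrix.conjTranspose_eq_transpose_of_trivial] at h
  exact h.inv.smul (by positivity)

-- The spectral bound says S ≤ C·1 in the Loewner order.
open scoped MatrixOrder in
theorem dotProduct_mulVec_le_of_spectrum_le {m : ℕ} {S : Matrix (Fin m) (Fin m) ℝ}
    (hS : S.PosSemidef) {C : ℝ} (h : ∀ μ ∈ spectrum ℝ S, μ ≤ C) (v : Fin m → ℝ) :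
    v ⬝ᵥ S.mulVec v ≤ C * ‖WithLp.toLp 2 v‖ ^ 2 := by
  have hsa := hS.1.isSelfAdjoint
  have hle : S ≤ algebraMap ℝ _ C := (le_algebraMap_iff_spectrum_le).2 h
  have h1 := (Matrix.le_iff.1 hle).dotProduct_mulVec_nonneg v
  rw [Matrix.sub_mulVec, dotProduct_sub, Algebra.algebraMap_eq_smul_one, Matrix.smul_mulVec,
    Matrix.one_mulVec, dotProduct_smul, star_trivial, smul_eq_mul] at h1
  have h2 : v ⬝ᵥ v = ‖WithLp.toLp 2 v‖ ^ 2 := by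
    rw [EuclideanSpace.norm_sq_eq, dotProduct]
    exact Finset.sum_congr rfl fun j _ => by simp [sq]
  rw [h2] at h1
  linarith

theorem hasSubgaussianMGF_multivariateGaussian {m : ℕ} {S : Matrix (Fin m) (Fin m) ℝ}
    (hS : S.PosSemidef) {C : ℝ} (h : ∀ μ ∈ spectrum ℝ S, μ ≤ C) (v : Fin m → ℝ) {c : NNReal}
    (hc : C * ‖WithLp.toLp 2 v‖ ^ 2 ≤ c) :
    HasSubgaussianMGF (fun x : EuclideanSpace ℝ (Fin m) => v ⬝ᵥ x.ofLp) c
      (multivariateGaussian 0 S) := by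
  have hL : (fun x : EuclideanSpace ℝ (Fin m) => v ⬝ᵥ x.ofLp) =
      innerSL ℝ (WithLp.toLp 2 v) := by
    ext x
    rw [innerSL_apply_apply, EuclideanSpace.inner_eq_star_dotProduct, star_trivial, dotProduct_comm]
  have hmap := IsGaussian.map_eq_gaussianReal (μ := multivariateGaussian 0 S)
    (innerSL ℝ (WithLp.toLp 2 v))
  have hmean : ∫ x, innerSL ℝ (WithLp.toLp 2 v) x ∂(multivariateGaussian 0 S) = 0 := by
    rw [ContinuousLinearMap.integral_comp_id_comm, integral_id_multivariateGaussian, map_zero]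
    exact IsGaussian.integrable_id
  have hvar : Var[innerSL ℝ (WithLp.toLp 2 v); multivariateGaussian 0 S] = v ⬝ᵥ S.mulVec v := by
    have := covarianceBilin_self (μ := multivariateGaussian 0 S) IsGaussian.memLp_two_id
      (WithLp.toLp 2 v)
    rw [covarianceBilin_multivariateGaussian hS] at this
    exact this.symm
  rw [hmean, hvar] at hmap
  rw [hL]
  refine hasSubgaussianMGF_mono (hasSubgaussianMGF_of_map_eq hmap (by fun_prop)) ?_
  rw [Real.toNNReal_le_iff_le_coe]
  exact (dotProduct_mulVec_le_of_spectrum_le hS h v).trans hc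

/-! ### Convolution with a summable sequence -/

/-- The coefficients of the linear form `b ↦ ρᵀ T_l(b) f`. -/
def correlation {l : ℕ} (ρ f : Fin (l + 1) → ℝ) (k : Fin (l + 1)) : ℝ :=
  ∑ j : Fin (l + 1), (∑ i : Fin (l + 1), if (k : ℕ) + j = i then ρ i else 0) * f j

theorem dotProduct_toeplitz_mulVec {l : ℕ} (b : ℕ → ℝ) (ρ f : Fin (l + 1) → ℝ) :
    ρ ⬝ᵥ (toeplitz b l).mulVec f = ∑ k, correlation ρ f k * b k := by
  have hinner : ∀ i j : Fin (l + 1), toeplitz b l i j = ∑ k : Fin (l + 1),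
      if (k : ℕ) + j = i then b k else 0 := by
    intro i j
    simp only [toeplitz, Matrix.of_apply]
    split_ifs with hij
    · rw [Finset.sum_eq_single ⟨(i : ℕ) - j, by omega⟩]
      · rw [if_pos (by simp only []; omega)]
      · intro k _ hk
        rw [if_neg fun h => hk (Fin.ext (by simp only []; omega))]
      · simp
    · exact (Finset.sum_eq_zero fun k _ => if_neg (by omega)).symm
  simp only [dotProduct, Matrix.mulVec, correlation, hinner, Finset.mul_sum, Finset.sum_mul]
  rw [Finset.sum_congr rfl fun i _ => Finset.sum_comm, Finset.sum_comm (γ := Fin (l + 1))]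
  refine Finset.sum_congr rfl fun k _ => ?_
  rw [Finset.sum_comm]
  refine Finset.sum_congr rfl fun j _ => Finset.sum_congr rfl fun i _ => ?_
  split_ifs <;> ring

/-- Young's inequality ℓ¹ ∗ ℓ² ⊆ ℓ², by Cauchy–Schwarz with weights |f_j|: each shift of ρ has norm
at most ‖ρ‖. The bound has no factor growing with l, unlike one through the norm of the Toeplitz
matrix. -/
theorem sum_sq_correlation_le {l : ℕ} (ρ f : Fin (l + 1) → ℝ) :
    ∑ k, correlation ρ f k ^ 2 ≤ (∑ j, |f j|) ^ 2 * ‖WithLp.toLp 2 ρ‖ ^ 2 := by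
  set g : Fin (l + 1) → Fin (l + 1) → ℝ := fun k j =>
    ∑ i : Fin (l + 1), if (k : ℕ) + j = i then ρ i else 0
  have hg : ∀ k j, g k j ^ 2 = ∑ i : Fin (l + 1), if (k : ℕ) + j = i then ρ i ^ 2 else 0 := by
    intro k j
    by_cases h : (k : ℕ) + j < l + 1
    · have : ∀ i : Fin (l + 1), ((k : ℕ) + j = i) = ((⟨(k : ℕ) + j, h⟩ : Fin (l + 1)) = i) :=
        fun i => by rw [Fin.ext_iff]
      simp only [g, this, Finset.sum_ite_eq, Finset.mem_univ, if_true]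
    · have : ∀ i : Fin (l + 1), ((k : ℕ) + j = i) = False := fun i => by
        simp only [eq_iff_iff, iff_false]; omega
      simp [g, this]
  have hgs : ∀ j, ∑ k, g k j ^ 2 ≤ ‖WithLp.toLp 2 ρ‖ ^ 2 := by
    intro j
    simp_rw [hg]
    rw [Finset.sum_comm, EuclideanSpace.norm_sq_eq]
    refine Finset.sum_le_sum fun i _ => ?_
    rw [Real.norm_eq_abs, sq_abs]
    by_cases h : (j : ℕ) ≤ i
    · have : ∀ k : Fin (l + 1), ((k : ℕ) + j = i) =
          (k = (⟨(i : ℕ) - j, by omega⟩ : Fin (l + 1))) := fun k => by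
        rw [Fin.ext_iff, eq_iff_iff]; simp only []; omega
      simp [this]
    · have : ∀ k : Fin (l + 1), ((k : ℕ) + j = i) = False := fun k => by
        simp only [eq_iff_iff, iff_false]; omega
      simp only [this, if_false, Finset.sum_const_zero]
      positivity
  have hck : ∀ k, correlation ρ f k ^ 2 ≤ (∑ j, |f j|) * ∑ j, |f j| * g k j ^ 2 := by
    intro k
    have h := Finset.sum_mul_sq_le_sq_mul_sq Finset.univ (fun j => √|f j|)
      (fun j => √|f j| * |g k j|)
    have h1 : |correlation ρ f k| ≤ ∑ j, √|f j| * (√|f j| * |g k j|) := by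
      refine (Finset.abs_sum_le_sum_abs _ _).trans (le_of_eq ?_)
      refine Finset.sum_congr rfl fun j _ => ?_
      rw [← mul_assoc, Real.mul_self_sqrt (abs_nonneg _), abs_mul, mul_comm]
    simp only [mul_pow, Real.sq_sqrt (abs_nonneg _), sq_abs] at h
    refine le_trans ?_ h
    rw [← sq_abs]
    gcongr
  calc ∑ k, correlation ρ f k ^ 2 ≤ ∑ k, (∑ j, |f j|) * ∑ j, |f j| * g k j ^ 2 :=
        Finset.sum_le_sum fun k _ => hck k
    _ = (∑ j, |f j|) * ∑ j, |f j| * ∑ k, g k j ^ 2 := by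
        rw [← Finset.mul_sum, Finset.sum_comm]
        simp_rw [Finset.mul_sum]
    _ ≤ (∑ j, |f j|) * ∑ j, |f j| * ‖WithLp.toLp 2 ρ‖ ^ 2 := by
        gcongr with j
        exact hgs j
    _ = _ := by rw [← Finset.sum_mul]; ring

/-! ### Perturbation of the operator -/

section Perturbation

variable {m : ℕ} {K B : Matrix (Fin m) (Fin m) ℝ} {δ q : ℝ}

theorem opNorm_add_le (A B : Matrix (Fin m) (Fin m) ℝ) : opNorm (A + B) ≤ opNorm A + opNorm B := by
  rw [opNorm, map_add]
  exact norm_add_le _ _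

theorem opNorm_smul (c : ℝ) (A : Matrix (Fin m) (Fin m) ℝ) : opNorm (c • A) = |c| * opNorm A := by
  rw [opNorm, map_smul, norm_smul, Real.norm_eq_abs, opNorm]

theorem opNorm_neg (A : Matrix (Fin m) (Fin m) ℝ) : opNorm (-A) = opNorm A := by
  rw [opNorm, map_neg, norm_neg, opNorm]

/-- Resolvent identity, the source of every perturbation bound below. -/
theorem inv_add_smul_eq (hK : IsUnit K) (hA : IsUnit (K + δ • B)) :
    (K + δ • B)⁻¹ = K⁻¹ - δ • (K⁻¹ * B * (K + δ • B)⁻¹) := by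
  have hK' := (Matrix.isUnit_iff_isUnit_det _).1 hK
  have hA' := (Matrix.isUnit_iff_isUnit_det _).1 hA
  have h : K⁻¹ * ((K + δ • B) * (K + δ • B)⁻¹) = K⁻¹ := by
    rw [Matrix.mul_nonsing_inv _ hA', mul_one]
  rw [← mul_assoc, mul_add, add_mul, Matrix.nonsing_inv_mul _ hK', one_mul, Matrix.mul_smul,
    Matrix.smul_mul] at h
  exact eq_sub_of_add_eq h

theorem opNorm_inv_add_smul_le (hK : IsUnit K) (hA : IsUnit (K + δ • B)) (hδ : 0 ≤ δ)
    (hq : opNorm K⁻¹ ≤ q) :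
    opNorm (K + δ • B)⁻¹ ≤ q * (1 + δ * opNorm B * opNorm (K + δ • B)⁻¹) := by
  have h0 := opNorm_nonneg K⁻¹
  have h1 := opNorm_nonneg B
  have h2 := opNorm_nonneg (K + δ • B)⁻¹
  calc opNorm (K + δ • B)⁻¹ = opNorm (K⁻¹ + -(δ • (K⁻¹ * B * (K + δ • B)⁻¹))) := by
        conv_lhs => rw [inv_add_smul_eq hK hA, sub_eq_add_neg]
    _ ≤ opNorm K⁻¹ + δ * (opNorm K⁻¹ * opNorm B * opNorm (K + δ • B)⁻¹) := by
        refine (opNorm_add_le _ _).trans ?_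
        rw [opNorm_neg, opNorm_smul, abs_of_nonneg hδ]
        gcongr
        refine (opNorm_mul_le _ _).trans ?_
        gcongr
        exact opNorm_mul_le _ _
    _ = opNorm K⁻¹ * (1 + δ * opNorm B * opNorm (K + δ • B)⁻¹) := by ring
    _ ≤ _ := by gcongr

/-- A kernel vector satisfies v = −δK⁻¹Bv, and the right side is a strict contraction. -/
theorem isUnit_add_smul (hK : IsUnit K) (hδ : 0 ≤ δ) (hq : opNorm K⁻¹ ≤ q)
    (h : q * (δ * opNorm B) < 1) : IsUnit (K + δ • B) := by
  have hK' := (Matrix.isUnit_iff_isUnit_det _).1 hK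
  rw [← Matrix.mulVec_injective_iff_isUnit, ← Matrix.coe_mulVecLin,
    ← LinearMap.ker_eq_bot, LinearMap.ker_eq_bot']
  intro v hv
  rw [Matrix.mulVecLin_apply, Matrix.add_mulVec, Matrix.smul_mulVec] at hv
  have h1 : v = -(δ • K⁻¹.mulVec (B.mulVec v)) := by
    have := congrArg (K⁻¹.mulVec) hv
    rw [Matrix.mulVec_add, Matrix.mulVec_mulVec, Matrix.nonsing_inv_mul _ hK', Matrix.one_mulVec,
      Matrix.mulVec_smul, Matrix.mulVec_zero] at this
    exact eq_neg_of_add_eq_zero_left this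
  have h2 : ‖WithLp.toLp 2 v‖ ≤ q * (δ * opNorm B) * ‖WithLp.toLp 2 v‖ := by
    have h0 := opNorm_nonneg K⁻¹
    calc ‖WithLp.toLp 2 v‖ = δ * ‖WithLp.toLp 2 (K⁻¹.mulVec (B.mulVec v))‖ := by
          conv_lhs => rw [h1, WithLp.toLp_neg, WithLp.toLp_smul, norm_neg, norm_smul,
            Real.norm_eq_abs, abs_of_nonneg hδ]
      _ ≤ δ * (q * (opNorm B * ‖WithLp.toLp 2 v‖)) := by
          gcongr
          refine (norm_toLp_mulVec_le _ _).trans ?_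
          gcongr
          · exact h0.trans hq
          · exact norm_toLp_mulVec_le _ _
      _ = _ := by ring
  have h3 : ‖WithLp.toLp 2 v‖ = 0 := by
    have := norm_nonneg (WithLp.toLp 2 v)
    nlinarith
  have h4 := norm_eq_zero.1 h3
  simpa using h4

/-- The data Kf + ξ equal (K + δB)f + (ξ − δBf). -/
theorem inv_mulVec_add_sub (hA : IsUnit (K + δ • B)) (f ξ : Fin m → ℝ) :
    (K + δ • B)⁻¹.mulVec (K.mulVec f + ξ) - f =
      (K + δ • B)⁻¹.mulVec ξ - δ • (K + δ • B)⁻¹.mulVec (B.mulVec f) := by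
  have hA' := (Matrix.isUnit_iff_isUnit_det _).1 hA
  have h : K.mulVec f + ξ = (K + δ • B).mulVec f + (ξ - δ • B.mulVec f) := by
    rw [Matrix.add_mulVec, Matrix.smul_mulVec]
    abel
  rw [h, Matrix.mulVec_add, Matrix.mulVec_mulVec, Matrix.nonsing_inv_mul _ hA', Matrix.one_mulVec,
    Matrix.mulVec_sub, Matrix.mulVec_smul]
  abel

/-- One step of the resolvent expansion: the main term becomes linear in B, so that its Gaussian
tail is available, and only the term carrying an extra δ is bounded through operator norms. -/
theorem abs_inv_mulVec_le (hK : IsUnit K) (hA : IsUnit (K + δ • B)) (hδ : 0 ≤ δ)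
    (hq : opNorm K⁻¹ ≤ q) (f : Fin m → ℝ) (i : Fin m) :
    |(K + δ • B)⁻¹.mulVec (B.mulVec f) i| ≤ |K⁻¹.mulVec (B.mulVec f) i| +
      δ * (q * opNorm B ^ 2 * opNorm (K + δ • B)⁻¹ * ‖WithLp.toLp 2 f‖) := by
  have h0 := opNorm_nonneg K⁻¹
  have h1 := opNorm_nonneg B
  have h2 := opNorm_nonneg (K + δ • B)⁻¹
  have h : (K + δ • B)⁻¹.mulVec (B.mulVec f) i = K⁻¹.mulVec (B.mulVec f) i -
      δ * (K⁻¹.mulVec (B.mulVec ((K + δ • B)⁻¹.mulVec (B.mulVec f)))) i := by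
    conv_lhs => rw [inv_add_smul_eq hK hA]
    rw [Matrix.sub_mulVec, Matrix.smul_mulVec, Pi.sub_apply, Pi.smul_apply, smul_eq_mul,
      ← Matrix.mulVec_mulVec, ← Matrix.mulVec_mulVec]
  rw [h]
  refine (abs_sub _ _).trans ?_
  rw [abs_mul, abs_of_nonneg hδ]
  gcongr
  refine (abs_apply_le_norm_toLp _ _).trans ?_
  calc _ ≤ opNorm K⁻¹ * (opNorm B * (opNorm (K + δ • B)⁻¹ * (opNorm B * ‖WithLp.toLp 2 f‖))) := by
        refine (norm_toLp_mulVec_le _ _).trans ?_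
        gcongr
        refine (norm_toLp_mulVec_le _ _).trans ?_
        gcongr
        refine (norm_toLp_mulVec_le _ _).trans ?_
        gcongr
        exact norm_toLp_mulVec_le _ _
    _ ≤ q * (opNorm B * (opNorm (K + δ • B)⁻¹ * (opNorm B * ‖WithLp.toLp 2 f‖))) := by gcongr
    _ = _ := by ring

end Perturbation

/-! ### Hard thresholding -/

theorem abs_threshold_sub_le (z x S : ℝ) :
    |(if S < |z| then z else 0) - x| ≤ |x| + |z - x| := by
  split_ifs
  · exact le_add_of_nonneg_left (abs_nonneg _)
  · rw [zero_sub, abs_neg]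
    exact le_add_of_nonneg_right (abs_nonneg _)

/-- If z is kept then |x| > S/2 already exceeds the error; if z is discarded the error is |x| ≤ |z −
x| + |z| ≤ 3S/2. -/
theorem abs_threshold_sub_le_of_le {z x S : ℝ} (h : |z - x| ≤ S / 2) :
    |(if S < |z| then z else 0) - x| ≤ |x| ∧ |(if S < |z| then z else 0) - x| ≤ 3 / 2 * S := by
  have hS : 0 ≤ S := by linarith [abs_nonneg (z - x)]
  have h1 : |z| ≤ |z - x| + |x| := by simpa using abs_add_le (z - x) x
  have h2 : |x| ≤ |z - x| + |z| := by
    have := abs_add_le (x - z) z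
    rwa [sub_add_cancel, abs_sub_comm] at this
  split_ifs with hz
  · exact ⟨by linarith, by linarith⟩
  · rw [zero_sub, abs_neg]
    exact ⟨le_rfl, by linarith⟩

/-! ### The error of one coefficient -/

section Level

variable {κ δ ε S q : ℝ} {l : ℕ} {K B : Matrix (Fin (l + 1)) (Fin (l + 1)) ℝ}
  {f ξ : Fin (l + 1) → ℝ}

/-- Crude bound valid on every outcome: the acceptance test alone limits the inverse. It is used on
the bad operator event. -/
theorem abs_threshold_zeta_sub_le (hδ : 0 ≤ δ) (hε : 0 ≤ ε) (hO : 0 < opThreshold κ δ l) :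
    |(if S < |zeta κ δ l (K + δ • B) (K.mulVec f + ε • ξ)| then
        zeta κ δ l (K + δ • B) (K.mulVec f + ε • ξ) else 0) - f (Fin.last l)| ≤
      |f (Fin.last l)| + (opThreshold κ δ l)⁻¹ *
        (δ * opNorm B * ‖WithLp.toLp 2 f‖ + ε * ‖WithLp.toLp 2 ξ‖) := by
  have hB := opNorm_nonneg B
  have hO' := (inv_pos.2 hO).le
  by_cases hv : IsUnit (K + δ • B) ∧ opNorm (K + δ • B)⁻¹ < (opThreshold κ δ l)⁻¹
  · refine (abs_threshold_sub_le _ _ _).trans ?_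
    rw [zeta, if_pos hv]
    gcongr
    have h := congrFun (inv_mulVec_add_sub hv.1 f (ε • ξ)) (Fin.last l)
    rw [Pi.sub_apply] at h
    rw [h, Pi.sub_apply, Pi.smul_apply, Matrix.mulVec_smul, Pi.smul_apply, smul_eq_mul, smul_eq_mul]
    have hN := opNorm_nonneg (K + δ • B)⁻¹
    have h1 : |(K + δ • B)⁻¹.mulVec ξ (Fin.last l)| ≤
        (opThreshold κ δ l)⁻¹ * ‖WithLp.toLp 2 ξ‖ := by
      refine (abs_apply_le_norm_toLp _ _).trans ((norm_toLp_mulVec_le _ _).trans ?_)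
      gcongr
      exact hv.2.le
    have h2 : |(K + δ • B)⁻¹.mulVec (B.mulVec f) (Fin.last l)| ≤
        (opThreshold κ δ l)⁻¹ * (opNorm B * ‖WithLp.toLp 2 f‖) := by
      refine (abs_apply_le_norm_toLp _ _).trans ((norm_toLp_mulVec_le _ _).trans ?_)
      gcongr
      · exact hv.2.le
      · exact norm_toLp_mulVec_le _ _
    refine (abs_sub _ _).trans ?_
    rw [abs_mul, abs_mul, abs_of_nonneg hδ, abs_of_nonneg hε]
    calc _ ≤ ε * ((opThreshold κ δ l)⁻¹ * ‖WithLp.toLp 2 ξ‖) +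
          δ * ((opThreshold κ δ l)⁻¹ * (opNorm B * ‖WithLp.toLp 2 f‖)) := by gcongr
      _ = _ := by ring
  · rw [zeta, if_neg hv]
    simp only [ite_self, zero_sub, abs_neg]
    exact le_add_of_nonneg_right (by positivity)

/-- On the event where the perturbation of the operator is moderate, the error of a coefficient is
controlled unless the noise of the signal is large. -/
theorem abs_threshold_zeta_sub_le_or (hδ : 0 ≤ δ) (hε : 0 ≤ ε) (hO : 0 < opThreshold κ δ l)
    (hK : IsUnit K) (hq : opNorm K⁻¹ ≤ q) (hB : δ * opNorm B ≤ opThreshold κ δ l / 2)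
    (hf : δ * (|K⁻¹.mulVec (B.mulVec f) (Fin.last l)| +
      δ * (q * opNorm B ^ 2 * (2 * q) * ‖WithLp.toLp 2 f‖)) ≤ S / 4)
    {low : Prop} [Decidable low] (hlow : low → 2 * q * opThreshold κ δ l < 1) :
    |(if S < |zeta κ δ l (K + δ • B) (K.mulVec f + ε • ξ)| then
        zeta κ δ l (K + δ • B) (K.mulVec f + ε • ξ) else 0) - f (Fin.last l)| ≤
      (if low then 3 / 2 * S else |f (Fin.last l)|) ∨
    (opNorm (K + δ • B)⁻¹ ≤ 2 * q ∧ S / 4 < ε * |(K + δ • B)⁻¹.mulVec ξ (Fin.last l)| ∧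
      |(if S < |zeta κ δ l (K + δ • B) (K.mulVec f + ε • ξ)| then
          zeta κ δ l (K + δ • B) (K.mulVec f + ε • ξ) else 0) - f (Fin.last l)| ≤
        |f (Fin.last l)| + 2 * (ε * |(K + δ • B)⁻¹.mulVec ξ (Fin.last l)|)) := by
  have hq0 : 0 ≤ q := (opNorm_nonneg _).trans hq
  have hB0 := opNorm_nonneg B
  by_cases hv : IsUnit (K + δ • B) ∧ opNorm (K + δ • B)⁻¹ < (opThreshold κ δ l)⁻¹
  · have hN0 := opNorm_nonneg (K + δ • B)⁻¹
    -- Acceptance gives δ‖B‖‖A⁻¹‖ ≤ 1/2 for A = K + δB, so the resolvent bound reads ‖A⁻¹‖ ≤ (3/2)q.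
    have hN : opNorm (K + δ • B)⁻¹ ≤ 2 * q := by
      refine (opNorm_inv_add_smul_le hK hv.1 hδ hq).trans ?_
      have : δ * opNorm B * opNorm (K + δ • B)⁻¹ ≤
          opThreshold κ δ l / 2 * (opThreshold κ δ l)⁻¹ := by
        gcongr
        exact hv.2.le
      rw [div_mul_eq_mul_div, mul_inv_cancel₀ hO.ne'] at this
      nlinarith
    have h := congrFun (inv_mulVec_add_sub hv.1 f (ε • ξ)) (Fin.last l)
    rw [Pi.sub_apply, Pi.sub_apply, Pi.smul_apply, Matrix.mulVec_smul, Pi.smul_apply, smul_eq_mul,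
      smul_eq_mul] at h
    have hop : δ * |(K + δ • B)⁻¹.mulVec (B.mulVec f) (Fin.last l)| ≤ S / 4 := by
      refine le_trans ?_ hf
      gcongr
      refine (abs_inv_mulVec_le hK hv.1 hδ hq f _).trans ?_
      gcongr
    have hz : |zeta κ δ l (K + δ • B) (K.mulVec f + ε • ξ) - f (Fin.last l)| ≤
        ε * |(K + δ • B)⁻¹.mulVec ξ (Fin.last l)| + S / 4 := by
      rw [zeta, if_pos hv, h]
      refine (abs_sub _ _).trans ?_
      rw [abs_mul, abs_mul, abs_of_nonneg hδ, abs_of_nonneg hε]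
      gcongr
    by_cases hbig : S / 4 < ε * |(K + δ • B)⁻¹.mulVec ξ (Fin.last l)|
    · refine Or.inr ⟨hN, hbig, (abs_threshold_sub_le _ _ _).trans ?_⟩
      gcongr
      linarith
    · have := abs_threshold_sub_le_of_le (S := S) (hz.trans (by linarith [not_lt.1 hbig]))
      left
      by_cases hl : low
      · rw [if_pos hl]
        exact this.2
      · rw [if_neg hl]
        exact this.1
  · left
    -- At a low level qδ‖B‖ ≤ qO/2 < 1/4, so A is invertible and ‖A⁻¹‖ ≤ 2q < 1/O: rejection is
    -- impossible.
    have hnl : ¬ low := fun hl => hv <| by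
      have h2 := hlow hl
      have hu : IsUnit (K + δ • B) := by
        refine isUnit_add_smul hK hδ hq ?_
        have : q * (δ * opNorm B) ≤ q * (opThreshold κ δ l / 2) := by gcongr
        linarith
      refine ⟨hu, ?_⟩
      have hN0 := opNorm_nonneg (K + δ • B)⁻¹
      have h3 := opNorm_inv_add_smul_le hK hu hδ hq
      have h4 : q * (δ * opNorm B) ≤ q * (opThreshold κ δ l / 2) := by gcongr
      have h5 : opNorm (K + δ • B)⁻¹ ≤ 2 * q := by nlinarith
      refine h5.trans_lt ?_
      rwa [← one_div, lt_div_iff₀ hO]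
    rw [zeta, if_neg hv, if_neg hnl]
    simp

end Level

/-! ### Expected error of one coefficient -/

theorem norm_toLp_sq {m : ℕ} (v : Fin m → ℝ) : ‖WithLp.toLp 2 v‖ ^ 2 = ∑ i, v i ^ 2 := by
  rw [EuclideanSpace.norm_sq_eq]
  exact Finset.sum_congr rfl fun i _ => by rw [Real.norm_eq_abs, sq_abs]

theorem norm_toLp_le_sum_abs {m : ℕ} (v : Fin m → ℝ) : ‖WithLp.toLp 2 v‖ ≤ ∑ i, |v i| := by
  refine abs_le_of_sq_le_sq' ?_ (Finset.sum_nonneg fun i _ => abs_nonneg _) |>.2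
  rw [norm_toLp_sq]
  simp_rw [← sq_abs (v _)]
  exact Finset.sum_sq_le_sq_sum_of_nonneg fun i _ => abs_nonneg _

/-- Far from sharp, but polynomial in l and of finite expectation, which is enough on a rare event.
-/
theorem opNorm_toeplitz_sq_le (l : ℕ) (b : ℕ → ℝ) :
    opNorm (toeplitz b l) ^ 2 ≤ (l + 1) * ∑ k : Fin (l + 1), b k ^ 2 := by
  have h : opNorm (toeplitz b l) ≤ ∑ k : Fin (l + 1), |b k| := by
    refine opNorm_toeplitz_le l b fun r => (norm_sum_le _ _).trans ?_
    refine Finset.sum_le_sum fun k _ => ?_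
    rw [norm_mul, AddChar.norm_apply, mul_one, Complex.norm_real, Real.norm_eq_abs]
  calc _ ≤ (∑ k : Fin (l + 1), |b k|) ^ 2 := by
        gcongr
        exact opNorm_nonneg _
    _ ≤ _ := by
        have := sq_sum_le_card_mul_sum_sq (s := Finset.univ) (f := fun k : Fin (l + 1) => |b k|)
        simpa using this

/-- Inversion is discontinuous at singular matrices, so measurability goes through the adjugate and
the determinant. -/
theorem measurable_inv_add_toeplitz_row {l : ℕ} (K : Matrix (Fin (l + 1)) (Fin (l + 1)) ℝ) (δ : ℝ)
    (i : Fin (l + 1)) :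
    Measurable fun b : ℕ → ℝ => (K + δ • toeplitz b l)⁻¹ i := by
  have hc : Continuous fun b : ℕ → ℝ => K + δ • toeplitz b l := by
    refine continuous_const.add (Continuous.const_smul ?_ δ)
    refine continuous_matrix fun i j => ?_
    simp only [toeplitz, Matrix.of_apply]
    split_ifs
    · exact continuous_apply _
    · exact continuous_const
  refine measurable_pi_iff.2 fun j => ?_
  simp only [Matrix.inv_def, Ring.inverse_eq_inv', Matrix.smul_apply, smul_eq_mul]
  exact hc.matrix_det.measurable.inv.mul (hc.matrix_adjugate.matrix_elem i j).measurable

/-- Exponential moment of a Gaussian vector in an independent random direction. -/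
theorem lintegral_exp_abs_dotProduct_le {Ω β : Type*} [MeasurableSpace Ω] [MeasurableSpace β]
    {P : Measure Ω} [IsProbabilityMeasure P] {m : ℕ} {S : Matrix (Fin m) (Fin m) ℝ}
    (hS : S.PosSemidef) {C : ℝ} (hC : 0 ≤ C) (hspec : ∀ μ ∈ spectrum ℝ S, μ ≤ C)
    {b : Ω → β} (hb : AEMeasurable b P) {ξ : Ω → EuclideanSpace ℝ (Fin m)}
    (hξ : HasLaw ξ (multivariateGaussian 0 S) P) (hind : IndepFun b ξ P)
    {r : β → Fin m → ℝ} (hr : Measurable r) {ρ : ℝ} (hρ : ∀ x, ‖WithLp.toLp 2 (r x)‖ ≤ ρ) (u : ℝ) :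
    ∫⁻ ω, ENNReal.ofReal (Real.exp (u * |r (b ω) ⬝ᵥ (ξ ω).ofLp|)) ∂P ≤
      ENNReal.ofReal (2 * Real.exp (C * ρ ^ 2 * u ^ 2 / 2)) := by
  have hm : Measurable fun z : β × EuclideanSpace ℝ (Fin m) =>
      ENNReal.ofReal (Real.exp (u * |r z.1 ⬝ᵥ z.2.ofLp|)) := by
    have h1 : Measurable fun z : β × EuclideanSpace ℝ (Fin m) => r z.1 ⬝ᵥ z.2.ofLp := by
      simp only [dotProduct]
      refine Finset.measurable_sum _ fun i _ => Measurable.mul ?_ ?_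
      · exact (measurable_pi_apply i).comp (hr.comp measurable_fst)
      · fun_prop
    exact ((h1.abs.const_mul u).exp).ennreal_ofReal
  have hP := (indepFun_iff_map_prod_eq_prod_map_map hb hξ.aemeasurable).1 hind
  have hbP : IsProbabilityMeasure (P.map b) := Measure.isProbabilityMeasure_map hb
  calc _ = ∫⁻ z, ENNReal.ofReal (Real.exp (u * |r z.1 ⬝ᵥ z.2.ofLp|))
        ∂(P.map fun ω => (b ω, ξ ω)) :=
        (lintegral_map' hm.aemeasurable (hb.prodMk hξ.aemeasurable)).symm
    _ = ∫⁻ x, ∫⁻ y, ENNReal.ofReal (Real.exp (u * |r x ⬝ᵥ y.ofLp|)) ∂(multivariateGaussian 0 S)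
        ∂(P.map b) := by
        rw [hP, hξ.map_eq, lintegral_prod _ hm.aemeasurable]
    _ ≤ ∫⁻ _, ENNReal.ofReal (2 * Real.exp (C * ρ ^ 2 * u ^ 2 / 2)) ∂(P.map b) := by
        refine lintegral_mono fun x => ?_
        have hρ0 : 0 ≤ ρ := (norm_nonneg _).trans (hρ x)
        have := lintegral_exp_mul_abs_le (hasSubgaussianMGF_multivariateGaussian hS hspec (r x)
          (c := (C * ρ ^ 2).toNNReal) (by
            rw [Real.coe_toNNReal _ (by positivity)]
            gcongr
            exact hρ x)) u
        rwa [Real.coe_toNNReal _ (by positivity)] at this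
    _ = _ := by simp

section Expectation

variable {Ω : Type*} [MeasurableSpace Ω] {P : Measure Ω}
  {b : ℕ → Ω → ℝ} {l : ℕ} {ξ : Ω → EuclideanSpace ℝ (Fin (l + 1))}

theorem lintegral_sum_sq_gaussian_le (hlaw : ∀ k, HasLaw (b k) (gaussianReal 0 1) P) (n : ℕ) :
    ∫⁻ ω, ENNReal.ofReal (∑ k : Fin n, b k ω ^ 2) ∂P ≤ ENNReal.ofReal (n * (4 * Real.exp (1 / 2))) := by
  simp_rw [ENNReal.ofReal_sum_of_nonneg fun (k : Fin n) _ => sq_nonneg (b k _)]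
  rw [lintegral_finsetSum' _ fun k _ => by have := (hlaw k).aemeasurable; fun_prop]
  calc _ ≤ ∑ k : Fin n, ENNReal.ofReal (4 * Real.exp (1 / 2)) := by
        refine Finset.sum_le_sum fun k _ => ?_
        exact lintegral_sq_le (hasSubgaussianMGF_of_map_eq (hlaw k).map_eq (hlaw k).aemeasurable)
    _ = _ := by
        rw [Finset.sum_const, Finset.card_univ, Fintype.card_fin, nsmul_eq_mul,
          ENNReal.ofReal_mul (p := (n : ℝ)) (by positivity), ENNReal.ofReal_natCast]

theorem lintegral_sum_sq_multivariateGaussian_le {S : Matrix (Fin (l + 1)) (Fin (l + 1)) ℝ}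
    (hS : S.PosSemidef) {C : ℝ} (hC : 0 ≤ C) (hspec : ∀ μ ∈ spectrum ℝ S, μ ≤ C)
    (hξ : HasLaw ξ (multivariateGaussian 0 S) P) :
    ∫⁻ ω, ENNReal.ofReal (∑ i, (ξ ω).ofLp i ^ 2) ∂P ≤
      ENNReal.ofReal ((l + 1) * (4 * Real.exp (C / 2))) := by
  have hmi : ∀ i, AEMeasurable (fun ω => (ξ ω).ofLp i) P := fun i => by
    have : Measurable fun x : EuclideanSpace ℝ (Fin (l + 1)) => x.ofLp i := by fun_prop
    exact this.comp_aemeasurable hξ.aemeasurable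
  simp_rw [ENNReal.ofReal_sum_of_nonneg fun i _ => sq_nonneg ((ξ _).ofLp i)]
  rw [lintegral_finsetSum' _ fun i _ => by have := hmi i; fun_prop]
  calc _ ≤ ∑ i : Fin (l + 1), ENNReal.ofReal (4 * Real.exp (C / 2)) := by
        refine Finset.sum_le_sum fun i _ => ?_
        have h1 := hasSubgaussianMGF_multivariateGaussian hS hspec (Pi.single i 1)
          (c := C.toNNReal) (by rw [norm_toLp_sq, Real.coe_toNNReal _ hC]; simp [Pi.single_apply])
        simp only [single_dotProduct, one_mul] at h1
        rw [← hξ.map_eq] at h1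
        have h2 := lintegral_sq_le (h1.of_map hξ.aemeasurable)
        rwa [Real.coe_toNNReal _ hC] at h2
    _ = _ := by
        rw [Finset.sum_const, Finset.card_univ, Fintype.card_fin, nsmul_eq_mul,
          ENNReal.ofReal_mul (p := (l + 1 : ℝ)) (by positivity), ← Nat.cast_succ,
          ENNReal.ofReal_natCast]

/-- Replaces Cauchy–Schwarz on rare events: on a set of probability p, the expectation of x is at
most t E x² + p/t. -/
theorem le_mul_sq_add_inv {t : ℝ} (ht : 0 < t) (x : ℝ) : x ≤ t * x ^ 2 + t⁻¹ := by
  have h : t * x ^ 2 + t⁻¹ - x = (t * x - 1 / 2) ^ 2 * t⁻¹ + 3 / 4 * t⁻¹ := by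
    field_simp; ring
  have : 0 ≤ (t * x - 1 / 2) ^ 2 * t⁻¹ + 3 / 4 * t⁻¹ := by positivity
  linarith

/-- A majorant, with small expectation, of the part of the error of one coefficient that is not
controlled deterministically. -/
theorem exists_majorant [IsProbabilityMeasure P]
    (hlaw : ∀ k, HasLaw (b k) (gaussianReal 0 1) P) (hind : iIndepFun b P)
    {Γ : Matrix (Fin (l + 1)) (Fin (l + 1)) ℝ} (hΓ : Γ.PosSemidef) {C : ℝ} (hC : 0 ≤ C)
    (hspec : ∀ μ ∈ spectrum ℝ Γ, μ ≤ C) (hξ : HasLaw ξ (multivariateGaussian 0 Γ) P)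
    (hbξ : IndepFun (fun ω k => b k ω) ξ P)
    {κ δ ε S q M α β u t : ℝ} {V : NNReal} (hδ : 0 < δ) (hε : 0 < ε) (hε1 : ε ≤ 1)
    (hO : δ ≤ opThreshold κ δ l) (hα : 0 ≤ α) (hβ : 0 ≤ β) (hu : 0 < u) (ht : 0 < t)
    {K : Matrix (Fin (l + 1)) (Fin (l + 1)) ℝ} (hK : IsUnit K) (hq : opNorm K⁻¹ ≤ q)
    {f : Fin (l + 1) → ℝ} (hf : ∑ j, |f j| ≤ M) (hV : (M * q) ^ 2 ≤ V)
    (hβO : δ * β ≤ opThreshold κ δ l / 2)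
    (hαS : δ * (α + δ * (q * β ^ 2 * (2 * q) * M)) ≤ S / 4)
    {low : Prop} [Decidable low] (hlow : low → 2 * q * opThreshold κ δ l < 1) :
    ∃ G : Ω → ℝ≥0∞, AEMeasurable G P ∧
      ∫⁻ ω, G ω ∂P ≤ ENNReal.ofReal (
        3 * t * (M ^ 2 + M ^ 2 * (l + 1) * ((l + 1) * (4 * Real.exp (1 / 2))) +
          (δ⁻¹) ^ 2 * ((l + 1) * (4 * Real.exp (C / 2)))) +
        t⁻¹ * (8 * (l + 1) * Real.exp (-β ^ 2 / (8 * (l + 1))) +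
          2 * Real.exp (-α ^ 2 / (2 * V))) +
        (M + 2 * ε / u) * Real.exp (-(u * S / (4 * ε))) *
          (2 * Real.exp (C * (2 * q) ^ 2 * (2 * u) ^ 2 / 2))) ∧
      ∀ ω, ENNReal.ofReal |(if S < |zeta κ δ l (K + δ • toeplitz (fun k => b k ω) l)
              (K.mulVec f + ε • (ξ ω).ofLp)| then
            zeta κ δ l (K + δ • toeplitz (fun k => b k ω) l) (K.mulVec f + ε • (ξ ω).ofLp)
          else 0) - f (Fin.last l)| ≤
        ENNReal.ofReal (if low then 3 / 2 * S else |f (Fin.last l)|) + G ω := by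
  have hM : 0 ≤ M := (Finset.sum_nonneg fun i _ => abs_nonneg _).trans hf
  have hq0 : 0 ≤ q := (opNorm_nonneg _).trans hq
  have hfM : ‖WithLp.toLp 2 f‖ ≤ M := (norm_toLp_le_sum_abs f).trans hf
  have hflM : |f (Fin.last l)| ≤ M := (abs_apply_le_norm_toLp f _).trans hfM
  have hO0 : 0 < opThreshold κ δ l := hδ.trans_le hO
  have hb : AEMeasurable (fun ω k => b k ω) P :=
    aemeasurable_pi_iff.2 fun k => (hlaw k).aemeasurable
  have hbm : ∀ k, AEMeasurable (b k) P := fun k => (hlaw k).aemeasurable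
  have hmi : ∀ i, AEMeasurable (fun ω => (ξ ω).ofLp i) P := fun i => by
    have : Measurable fun x : EuclideanSpace ℝ (Fin (l + 1)) => x.ofLp i := by fun_prop
    exact this.comp_aemeasurable hξ.aemeasurable
  -- The two ways the operator noise can be large: the norm of B, and the first-order term ρᵀBf with
  -- ρ the last row of K⁻¹.
  set bad : Set Ω := {ω | β < opNorm (toeplitz (fun k => b k ω) l)} ∪
    {ω | α < |∑ k, correlation (K⁻¹ (Fin.last l)) f k * b k ω|}
  have hbad : P bad ≤ ENNReal.ofReal (8 * (l + 1) * Real.exp (-β ^ 2 / (8 * (l + 1))) +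
      2 * Real.exp (-α ^ 2 / (2 * V))) := by
    refine (measure_union_le _ _).trans ?_
    rw [ENNReal.ofReal_add (by positivity) (by positivity)]
    refine add_le_add (measure_lt_opNorm_toeplitz_le hlaw hind l hβ) (measure_lt_abs_le
      (hasSubgaussianMGF_sum hlaw hind _ ((sum_sq_correlation_le _ _).trans (le_trans ?_ hV))) hα)
    rw [mul_pow]
    have := (norm_toLp_row_le K⁻¹ (Fin.last l)).trans hq
    gcongr
  -- Last row of the noisy inverse, cut to 0 where its norm exceeds 2q. It is a measurable function
  -- of b with a uniform bound, as conditioning on b requires, and it is the true row whenever it is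
  -- needed.
  set r : (ℕ → ℝ) → Fin (l + 1) → ℝ := fun x =>
    if ‖WithLp.toLp 2 ((K + δ • toeplitz x l)⁻¹ (Fin.last l))‖ ≤ 2 * q then
      (K + δ • toeplitz x l)⁻¹ (Fin.last l) else 0
  have hrow := measurable_inv_add_toeplitz_row K δ (Fin.last l)
  have hr : Measurable r := by
    refine Measurable.ite ?_ hrow measurable_const
    refine measurableSet_le ?_ measurable_const
    exact ((PiLp.continuous_toLp 2 _).measurable.comp hrow).norm
  have hrq : ∀ x, ‖WithLp.toLp 2 (r x)‖ ≤ 2 * q := by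
    intro x
    by_cases h : ‖WithLp.toLp 2 ((K + δ • toeplitz x l)⁻¹ (Fin.last l))‖ ≤ 2 * q
    · simp only [r, if_pos h, h]
    · simp only [r, if_neg h, WithLp.toLp_zero, norm_zero]
      positivity
  -- Chernoff constant. With Y = |r · ξ|, |f_l| + 2εY ≤ (M + 2ε/u)e^(uY), and 1 ≤ e^(uY − uS/(4ε))
  -- where εY > S/4; the product is c₁e^(2uY).
  set c₁ : ℝ := (M + 2 * ε / u) * Real.exp (-(u * S / (4 * ε))) with hc₁
  have hc₁0 : 0 ≤ c₁ := by positivity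
  -- The quadratic terms are kept everywhere and only 1/t is restricted to the bad event, which is
  -- enlarged to a measurable hull of equal probability.
  set G₀ : Ω → ℝ≥0∞ := fun ω => ENNReal.ofReal (3 * t * M ^ 2) +
    ENNReal.ofReal (3 * t * (M ^ 2 * (l + 1))) * ENNReal.ofReal (∑ k : Fin (l + 1), b k ω ^ 2) +
    ENNReal.ofReal (3 * t * (δ⁻¹) ^ 2) * ENNReal.ofReal (∑ i, (ξ ω).ofLp i ^ 2) +
    ENNReal.ofReal t⁻¹ * (toMeasurable P bad).indicator 1 ω with hG₀
  set G₁ : Ω → ℝ≥0∞ := fun ω => ENNReal.ofReal c₁ *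
    ENNReal.ofReal (Real.exp (2 * u * |r (fun k => b k ω) ⬝ᵥ (ξ ω).ofLp|)) with hG₁
  have hm₁ : AEMeasurable (fun ω => ENNReal.ofReal (∑ k : Fin (l + 1), b k ω ^ 2)) P := by fun_prop
  have hm₂ : AEMeasurable (fun ω => ENNReal.ofReal (∑ i, (ξ ω).ofLp i ^ 2)) P := by fun_prop
  have hm₃ : AEMeasurable ((toMeasurable P bad).indicator (1 : Ω → ℝ≥0∞)) P :=
    (measurable_one.indicator (measurableSet_toMeasurable P bad)).aemeasurable
  have hm₄ : AEMeasurable G₁ P := by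
    have h1 : AEMeasurable (fun ω => r (fun k => b k ω) ⬝ᵥ (ξ ω).ofLp) P := by
      simp only [dotProduct]
      refine Finset.aemeasurable_fun_sum _ fun i _ => AEMeasurable.mul ?_ (hmi i)
      exact ((measurable_pi_apply i).comp hr).comp_aemeasurable hb
    have h2 : AEMeasurable (fun ω => 2 * u * |r (fun k => b k ω) ⬝ᵥ (ξ ω).ofLp|) P := by
      simp only [← Real.norm_eq_abs]
      exact h1.norm.const_mul _
    exact (Real.measurable_exp.comp_aemeasurable h2).ennreal_ofReal.const_mul _
  refine ⟨fun ω => G₀ ω + G₁ ω, ?_, ?_, fun ω => ?_⟩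
  · refine AEMeasurable.add ?_ hm₄
    exact ((aemeasurable_const.add (hm₁.const_mul _)).add (hm₂.const_mul _)).add (hm₃.const_mul _)
  · rw [lintegral_add_right' _ hm₄, hG₀, lintegral_add_right' _ (hm₃.const_mul _),
      lintegral_add_right' _ (hm₂.const_mul _), lintegral_add_right' _ (hm₁.const_mul _),
      lintegral_const, measure_univ, mul_one, lintegral_const_mul' _ _ ENNReal.ofReal_ne_top,
      lintegral_const_mul' _ _ ENNReal.ofReal_ne_top,
      lintegral_const_mul' _ _ ENNReal.ofReal_ne_top, hG₁,
      lintegral_const_mul' _ _ ENNReal.ofReal_ne_top,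
      lintegral_indicator_one (measurableSet_toMeasurable P bad), measure_toMeasurable]
    have e₁ := lintegral_sum_sq_gaussian_le hlaw (l + 1)
    have e₂ := lintegral_sum_sq_multivariateGaussian_le hΓ hC hspec hξ
    have e₃ := lintegral_exp_abs_dotProduct_le hΓ hC hspec hb hξ hbξ hr hrq (2 * u)
    refine (add_le_add (add_le_add (add_le_add (add_le_add le_rfl (mul_le_mul_right e₁ _))
      (mul_le_mul_right e₂ _)) (mul_le_mul_right hbad _)) (mul_le_mul_right e₃ _)).trans
        (le_of_eq ?_)
    rw [← ENNReal.ofReal_mul (by positivity), ← ENNReal.ofReal_mul (by positivity),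
      ← ENNReal.ofReal_mul (by positivity), ← ENNReal.ofReal_mul (by positivity),
      ← ENNReal.ofReal_add (by positivity) (by positivity),
      ← ENNReal.ofReal_add (by positivity) (by positivity),
      ← ENNReal.ofReal_add (by positivity) (by positivity),
      ← ENNReal.ofReal_add (by positivity) (by positivity)]
    congr 1
    push_cast
    ring
  · by_cases hω : ω ∈ bad
    · refine le_trans ?_ (le_add_left (le_add_right le_rfl))
      have hind1 : (toMeasurable P bad).indicator (1 : Ω → ℝ≥0∞) ω = ENNReal.ofReal 1 := by
        rw [Set.indicator_of_mem (subset_toMeasurable P bad hω)]; simp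
      rw [hG₀]
      simp only []
      rw [hind1, ← ENNReal.ofReal_mul (by positivity), ← ENNReal.ofReal_mul (by positivity),
        ← ENNReal.ofReal_mul (by positivity),
        ← ENNReal.ofReal_add (by positivity) (by positivity),
        ← ENNReal.ofReal_add (by positivity) (by positivity),
        ← ENNReal.ofReal_add (by positivity) (by positivity)]
      refine ENNReal.ofReal_le_ofReal ((abs_threshold_zeta_sub_le hδ.le hε.le hO0).trans ?_)
      have hB0 := opNorm_nonneg (toeplitz (fun k => b k ω) l)
      have hB2 := opNorm_toeplitz_sq_le l (fun k => b k ω)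
      rw [← norm_toLp_sq (ξ ω).ofLp]
      set N := ‖WithLp.toLp 2 (ξ ω).ofLp‖
      have hN0 : 0 ≤ N := norm_nonneg _
      set B := opNorm (toeplitz (fun k => b k ω) l)
      have hOi : (opThreshold κ δ l)⁻¹ ≤ δ⁻¹ := inv_anti₀ hδ hO
      calc _ ≤ M + δ⁻¹ * (δ * B * M + 1 * N) := by gcongr
        _ = M + B * M + δ⁻¹ * N := by linear_combination (B * M) * inv_mul_cancel₀ hδ.ne'
        _ ≤ t * (M + B * M + δ⁻¹ * N) ^ 2 + t⁻¹ := le_mul_sq_add_inv ht _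
        _ ≤ t * (3 * (M ^ 2 + M ^ 2 * B ^ 2 + (δ⁻¹) ^ 2 * N ^ 2)) + t⁻¹ := by
            gcongr
            nlinarith [sq_nonneg (M - B * M), sq_nonneg (M - δ⁻¹ * N), sq_nonneg (B * M - δ⁻¹ * N)]
        _ ≤ t * (3 * (M ^ 2 + M ^ 2 * ((l + 1) * ∑ k : Fin (l + 1), b k ω ^ 2) +
            (δ⁻¹) ^ 2 * N ^ 2)) + t⁻¹ := by gcongr
        _ = _ := by ring
    · simp only [bad, Set.mem_union, Set.mem_ofPred_eq, not_or, not_lt] at hω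
      have hdot : K⁻¹.mulVec ((toeplitz (fun k => b k ω) l).mulVec f) (Fin.last l) =
          ∑ k, correlation (K⁻¹ (Fin.last l)) f k * b k ω :=
        dotProduct_toeplitz_mulVec (fun k => b k ω) (K⁻¹ (Fin.last l)) f
      have hB0 := opNorm_nonneg (toeplitz (fun k => b k ω) l)
      have hdich := abs_threshold_zeta_sub_le_or (κ := κ) (ξ := (ξ ω).ofLp) (f := f)
        (B := toeplitz (fun k => b k ω) l) hδ.le hε.le hO0 hK hq
        ((mul_le_mul_of_nonneg_left hω.1 hδ.le).trans hβO) (le_trans (by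
          rw [hdot]
          gcongr
          · exact hω.2
          · exact hω.1) hαS) hlow
      rcases hdich with h | ⟨hN, hbig, herr⟩
      · exact (ENNReal.ofReal_le_ofReal h).trans (le_add_right le_rfl)
      · refine le_trans ?_ (le_add_left (le_add_left le_rfl))
        have hrr : r (fun k => b k ω) =
            (K + δ • toeplitz (fun k => b k ω) l)⁻¹ (Fin.last l) :=
          if_pos ((norm_toLp_row_le _ _).trans hN)
        have hY : (K + δ • toeplitz (fun k => b k ω) l)⁻¹.mulVec (ξ ω).ofLp (Fin.last l) =
            r (fun k => b k ω) ⬝ᵥ (ξ ω).ofLp := by rw [hrr]; rfl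
        rw [hG₁]
        simp only []
        rw [← ENNReal.ofReal_mul hc₁0]
        refine ENNReal.ofReal_le_ofReal (herr.trans ?_)
        rw [hY] at hbig ⊢
        set Y := |r (fun k => b k ω) ⬝ᵥ (ξ ω).ofLp|
        have hY0 : 0 ≤ Y := abs_nonneg _
        have h1 : 1 ≤ Real.exp (u * Y) := Real.one_le_exp (by positivity)
        have h2 : Y ≤ u⁻¹ * Real.exp (u * Y) := by
          rw [← div_eq_inv_mul, le_div_iff₀ hu, mul_comm]
          linarith [Real.add_one_le_exp (u * Y)]
        have h3 : 1 ≤ Real.exp (u * Y - u * S / (4 * ε)) := by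
          refine Real.one_le_exp (sub_nonneg.2 ?_)
          rw [div_le_iff₀ (by positivity)]
          nlinarith
        calc |f (Fin.last l)| + 2 * (ε * Y)
            ≤ M * Real.exp (u * Y) + 2 * (ε * (u⁻¹ * Real.exp (u * Y))) := by
              refine add_le_add (hflM.trans (le_mul_of_one_le_right hM h1)) ?_
              gcongr
          _ = (M + 2 * ε / u) * Real.exp (u * Y) := by ring
          _ ≤ (M + 2 * ε / u) * Real.exp (u * Y) * Real.exp (u * Y - u * S / (4 * ε)) :=
              le_mul_of_one_le_right (by positivity) h3
          _ = _ := by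
              rw [hc₁, mul_assoc, mul_assoc, ← Real.exp_add, ← Real.exp_add]
              ring_nf

end Expectation

/-! ### Elementary bounds on the levels -/

section Elementary

variable {δ ε lam ν s : ℝ}

theorem half_le_abs_log (hδ : 0 < δ) (h : δ ≤ 1 / 2) : 1 / 2 ≤ |Real.log δ| := by
  have h1 : Real.log δ ≤ Real.log (1 / 2) := Real.log_le_log hδ h
  rw [one_div, Real.log_inv] at h1
  have := Real.log_two_gt_d9
  rw [abs_of_neg (by linarith)]
  linarith

theorem exp_neg_mul_abs_log (hδ : 0 < δ) (h : δ ≤ 1 / 2) (n : ℕ) :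
    Real.exp (-(n * |Real.log δ|)) = δ ^ n := by
  rw [abs_of_neg (Real.log_neg hδ (by linarith)), mul_neg, neg_neg, Real.exp_nat_mul,
    Real.exp_log hδ]

theorem operatorSize_pos (hδ : 0 < δ) (h : δ ≤ 1 / 2) : 0 < operatorSize δ :=
  mul_pos hδ (by linarith [half_le_abs_log hδ h])

theorem le_two_mul_operatorSize (hδ : 0 < δ) (h : δ ≤ 1 / 2) : δ ≤ 2 * operatorSize δ := by
  have := half_le_abs_log hδ h
  rw [operatorSize]
  nlinarith

theorem operatorSize_le_one (hδ : 0 < δ) (h : δ ≤ 1 / 2) : operatorSize δ ≤ 1 := by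
  have h1 := Real.log_le_sub_one_of_pos (inv_pos.2 hδ)
  rw [Real.log_inv] at h1
  rw [operatorSize, abs_of_neg (Real.log_neg hδ (by linarith))]
  calc δ * -Real.log δ ≤ δ * (δ⁻¹ - 1) := by gcongr
    _ = 1 - δ := by field_simp
    _ ≤ 1 := by linarith

theorem half_le_sqrt_abs_log (hε : 0 < ε) (h : ε ≤ 1 / 2) : 1 / 2 ≤ √|Real.log ε| := by
  refine Real.le_sqrt_of_sq_le ?_
  have := half_le_abs_log hε h
  linarith

theorem signalSize_pos (hε : 0 < ε) (h : ε ≤ 1 / 2) : 0 < signalSize ε :=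
  mul_pos hε (by linarith [half_le_sqrt_abs_log hε h])

theorem le_two_mul_signalSize (hε : 0 < ε) (h : ε ≤ 1 / 2) : ε ≤ 2 * signalSize ε := by
  have := half_le_sqrt_abs_log hε h
  rw [signalSize]
  nlinarith

theorem signalSize_le_one (hε : 0 < ε) (h : ε ≤ 1 / 2) : signalSize ε ≤ 1 := by
  have h1 := operatorSize_le_one hε h
  have h2 : signalSize ε ^ 2 ≤ 1 := by
    rw [signalSize, mul_pow, Real.sq_sqrt (abs_nonneg _)]
    calc ε ^ 2 * |Real.log ε| = ε * operatorSize ε := by rw [operatorSize]; ring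
      _ ≤ 1 * 1 := by
          gcongr
          · exact (operatorSize_pos hε h).le
          · linarith
      _ = 1 := one_mul 1
  nlinarith [signalSize_pos hε h]

/-- The level L is defined so that L^(ν+1)η is a constant; this absorbs powers of the level into one
factor 1/η. -/
theorem level_rpow_le {η : ℝ} (hlam : 0 < lam) (hν : 0 ≤ ν) (hη : 0 < η) {x : ℝ} (hx : 0 ≤ x)
    (h : x ≤ lam * η ^ (-1 / (ν + 1))) : x ^ (ν + 1) ≤ lam ^ (ν + 1) / η := by
  calc x ^ (ν + 1) ≤ (lam * η ^ (-1 / (ν + 1))) ^ (ν + 1) := by gcongr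
    _ = lam ^ (ν + 1) / η := by
        rw [Real.mul_rpow hlam.le (by positivity), ← Real.rpow_mul hη.le,
          div_mul_cancel₀ _ (by positivity), Real.rpow_neg_one, div_eq_mul_inv]

theorem max_rpow_le {η : ℝ} (hlam : 0 < lam) (hν : 0 ≤ ν) (hη : 0 < η) (hη1 : η ≤ 1) {x : ℝ}
    (hx : 0 ≤ x) (h : x ≤ lam * η ^ (-1 / (ν + 1))) :
    max x 1 ^ (ν + 1) ≤ (lam ^ (ν + 1) + 1) / η := by
  have h1 := level_rpow_le hlam hν hη hx h
  have h2 : 0 ≤ lam ^ (ν + 1) / η := by positivity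
  have h3 : 1 ≤ 1 / η := (one_le_div hη).2 hη1
  rw [add_div]
  rcases le_total x 1 with h | h
  · rw [max_eq_right h, Real.one_rpow]
    linarith
  · rw [max_eq_left h]
    linarith

theorem level_le {η : ℝ} (hlam : 0 < lam) (hν : 0 ≤ ν) (hη : 0 < η) (hη1 : η ≤ 1) {x : ℝ}
    (h : x ≤ lam * η ^ (-1 / (ν + 1))) : x ≤ lam / η := by
  refine h.trans ?_
  have h1 : η ^ (-1 / (ν + 1)) ≤ η ^ (-1 : ℝ) := by
    refine Real.rpow_le_rpow_of_exponent_ge hη hη1 ?_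
    rw [le_div_iff₀ (by positivity)]
    linarith
  rw [Real.rpow_neg_one] at h1
  rw [div_eq_mul_inv lam]
  gcongr

theorem level_add_one_le {η : ℝ} (hlam : 0 < lam) (hν : 0 ≤ ν) (hη : 0 < η) (hη1 : η ≤ 1)
    (hδ : 0 < δ) (hδ1 : δ ≤ 1 / 2) (hδη : δ ≤ 2 * η) {x : ℝ}
    (h : x ≤ lam * η ^ (-1 / (ν + 1))) : x + 1 ≤ (2 * lam + 1) / δ := by
  have h1 := level_le hlam hν hη hη1 h
  rw [add_div]
  refine add_le_add (h1.trans ?_) ((one_le_div hδ).2 (by linarith))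
  rw [div_le_div_iff₀ hη hδ]
  nlinarith

theorem log_max_two_le {η : ℝ} (hlam : 0 < lam) (hν : 0 ≤ ν) (hη : 0 < η) (hη1 : η ≤ 1)
    (hδ : 0 < δ) (hδ1 : δ ≤ 1 / 2) (hδη : δ ≤ 2 * η) {x : ℝ}
    (h : x ≤ lam * η ^ (-1 / (ν + 1))) :
    Real.log (max x 2) ≤ (2 * Real.log (2 * lam + 1) + 1) * |Real.log δ| := by
  have hx := level_add_one_le hlam hν hη hη1 hδ hδ1 hδη h
  have hmax : max x 2 ≤ (2 * lam + 1) / δ := by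
    refine max_le (by linarith) ?_
    rw [le_div_iff₀ hδ]
    linarith
  have h1 := Real.log_le_log (by positivity) hmax
  rw [Real.log_div (by positivity) hδ.ne'] at h1
  -- Since |log δ| ≥ 1/2, the additive constant log(2 lam + 1) is at most 2 log(2 lam + 1)|log δ|.
  have h2 := half_le_abs_log hδ hδ1
  have h3 : |Real.log δ| = -Real.log δ := abs_of_neg (Real.log_neg hδ (by linarith))
  have h4 : 0 ≤ Real.log (2 * lam + 1) := Real.log_nonneg (by linarith)
  nlinarith

end Elementary

/-! ### Sobolev balls -/

theorem summable_add_half_rpow {s : ℝ} (hs : 1 / 2 < s) :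
    Summable fun l : ℕ => ((l : ℝ) + 1 / 2) ^ (-(2 * s)) := by
  have h := (Real.summable_one_div_nat_add_rpow (1 / 2) (2 * s)).2 (by linarith)
  refine h.congr fun l => ?_
  rw [abs_of_pos (by positivity), Real.rpow_neg (by positivity), one_div]

/-- Bound for the sum of the absolute values of the coefficients on a Sobolev ball. -/
noncomputable def sobolevSumBound (s M : ℝ) : ℝ :=
  √(∑' l : ℕ, ((l : ℝ) + 1 / 2) ^ (-(2 * s))) * M

/-- Cauchy–Schwarz against the weights (l + 1/2)^(−s), square summable exactly because s > 1/2. -/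
theorem sum_abs_coeff_le {s M : ℝ} (hs : 1 / 2 < s) (hM : 0 ≤ M) {f : ℝ → ℝ}
    (hf : f ∈ sobolevBall s M) (n : ℕ) :
    ∑ j : Fin n, |coeff f j| ≤ sobolevSumBound s M := by
  obtain ⟨-, hsum, hle⟩ := hf
  have hpt : ∀ l : ℕ, |coeff f l| = ((l : ℝ) + 1 / 2) ^ (-s) *
      (((l : ℝ) + 1 / 2) ^ s * |coeff f l|) := fun l => by
    rw [← mul_assoc, ← Real.rpow_add (by positivity), neg_add_cancel, Real.rpow_zero, one_mul]
  rw [Fin.sum_univ_eq_sum_range fun l => |coeff f l|, Finset.sum_congr rfl fun l _ => hpt l]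
  refine (Real.sum_mul_le_sqrt_mul_sqrt _ _ _).trans ?_
  rw [sobolevSumBound]
  gcongr
  · refine le_trans (le_of_eq ?_) ((summable_add_half_rpow hs).sum_le_tsum (Finset.range n)
      fun l _ => by positivity)
    refine Finset.sum_congr rfl fun l _ => ?_
    rw [← Real.rpow_natCast, ← Real.rpow_mul (by positivity)]
    congr 1
    push_cast; ring
  · refine Real.sqrt_le_iff.2 ⟨hM, le_trans (le_trans (le_of_eq ?_)
      (hsum.sum_le_tsum (Finset.range n) fun l _ => sq_nonneg _)) hle⟩
    refine Finset.sum_congr rfl fun l _ => ?_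
    rw [mul_pow, mul_pow, sq_abs]

/-! ### The deterministic part of the risk -/

/-- Bias–variance sum: thresholds below a cut-off, coefficients above it. -/
theorem exists_hasSum_bias_variance {s M ν τ c₁ η γ : ℝ} (hs : 1 / 2 < s) (hν : 0 ≤ ν) (hτ : 0 ≤ τ)
    (hη : 0 < η) (hη1 : η ≤ 1) (hγ : γ = 2 / (2 * (s + ν) + 1)) (hc₁ : 0 < c₁)
    {f : ℝ → ℝ} (hf : f ∈ sobolevBall s M) :
    ∃ (d : ℕ → ℝ) (D : ℝ), HasSum d D ∧
      D ≤ (9 / 2 * τ ^ 2 + c₁ ^ (-(2 * s)) * M ^ 2) * (η ^ (s * γ)) ^ 2 ∧ (∀ l, 0 ≤ d l) ∧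
      (∀ l : ℕ, max (l : ℝ) 1 < η ^ (-γ) → (3 / 2 * (max (l : ℝ) 1 ^ ν * (τ * η))) ^ 2 ≤ d l) ∧
      ∀ l : ℕ, c₁ * η ^ (-γ) ≤ l + 1 / 2 → coeff f l ^ 2 ≤ d l := by
  obtain ⟨-, hsum, hle⟩ := hf
  have hγ0 : 0 < γ := by rw [hγ]; positivity
  -- The cut-off x balances the two sums; d = v + w dominates both, so the low and high ranges may
  -- overlap.
  set x := η ^ (-γ) with hx
  have hx0 : 0 < x := Real.rpow_pos_of_pos hη _
  have hx1 : 1 ≤ x := Real.one_le_rpow_of_pos_of_le_one_of_nonpos hη hη1 (by linarith)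
  set v : ℕ → ℝ := fun l => if max (l : ℝ) 1 < x then (3 / 2 * (max (l : ℝ) 1 ^ ν * (τ * η))) ^ 2
    else 0 with hv
  set w : ℕ → ℝ := fun l => c₁ ^ (-(2 * s)) * (η ^ (s * γ)) ^ 2 *
    (((l : ℝ) + 1 / 2) ^ s * coeff f l) ^ 2 with hw
  have hv0 : ∀ l, 0 ≤ v l := fun l => by simp only [hv]; split_ifs <;> positivity
  have hw0 : ∀ l, 0 ≤ w l := fun l => by simp only [hw]; positivity
  have hvs : HasSum v (∑ l ∈ Finset.range ⌈x⌉₊, v l) := by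
    refine hasSum_sum_of_ne_finset_zero fun l hl => ?_
    simp only [hv]
    refine if_neg fun h => hl (Finset.mem_range.2 (Nat.lt_ceil.2 ((le_max_left _ _).trans_lt h)))
  have hws : HasSum w _ := hsum.hasSum.mul_left _
  refine ⟨fun l => v l + w l, _, hvs.add hws, ?_, fun l => add_nonneg (hv0 l) (hw0 l),
    fun l hl => ?_, fun l hl => ?_⟩
  · have hvle : ∑ l ∈ Finset.range ⌈x⌉₊, v l ≤ 9 / 2 * τ ^ 2 * (η ^ (s * γ)) ^ 2 := by
      calc _ ≤ ∑ l ∈ Finset.range ⌈x⌉₊, (3 / 2 * (x ^ ν * (τ * η))) ^ 2 := by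
            refine Finset.sum_le_sum fun l _ => ?_
            simp only [hv]
            split_ifs with h
            · gcongr
            · positivity
        _ ≤ 2 * x * (3 / 2 * (x ^ ν * (τ * η))) ^ 2 := by
            rw [Finset.sum_const, Finset.card_range, nsmul_eq_mul]
            gcongr
            linarith [Nat.ceil_lt_add_one hx0.le]
        _ = 9 / 2 * τ ^ 2 * (η ^ 2 * (x * x ^ ν * x ^ ν)) := by ring
        -- Exponents: 2 − γ(2ν + 1) = 2sγ. The factor 9/2 is (3/2)² times 2, from ⌈x⌉ ≤ 2x.
        _ = 9 / 2 * τ ^ 2 * (η ^ (s * γ)) ^ 2 := by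
            congr 1
            rw [hx, ← Real.rpow_mul hη.le, ← Real.rpow_natCast, ← Real.rpow_natCast,
              ← Real.rpow_mul hη.le, ← Real.rpow_add hη, ← Real.rpow_add hη, ← Real.rpow_add hη]
            congr 1
            rw [hγ]
            field_simp
            push_cast
            ring
    rw [add_mul]
    refine add_le_add hvle ?_
    calc _ ≤ c₁ ^ (-(2 * s)) * (η ^ (s * γ)) ^ 2 * M ^ 2 := by gcongr
      _ = _ := by ring
  · refine le_trans (le_of_eq ?_) (le_add_of_nonneg_right (hw0 l))
    simp only [hv]
    rw [if_pos hl]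
  · refine le_trans ?_ (le_add_of_nonneg_left (hv0 l))
    simp only [hw]
    have h1 : (c₁ * x) ^ (2 * s) ≤ ((l : ℝ) + 1 / 2) ^ (2 * s) := by gcongr
    have h2 : c₁ ^ (-(2 * s)) * (η ^ (s * γ)) ^ 2 * (c₁ * x) ^ (2 * s) = 1 := by
      rw [Real.mul_rpow hc₁.le hx0.le, hx, ← Real.rpow_mul hη.le, ← Real.rpow_natCast,
        ← Real.rpow_mul hη.le,
        show c₁ ^ (-(2 * s)) * η ^ (s * γ * ((2 : ℕ) : ℝ)) * (c₁ ^ (2 * s) * η ^ (-γ * (2 * s))) =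
          (c₁ ^ (-(2 * s)) * c₁ ^ (2 * s)) * (η ^ (s * γ * ((2 : ℕ) : ℝ)) * η ^ (-γ * (2 * s)))
          by ring, ← Real.rpow_add hc₁, ← Real.rpow_add hη]
      rw [show s * γ * ((2 : ℕ) : ℝ) + -γ * (2 * s) = 0 by push_cast; ring]
      simp
    have h3 : (((l : ℝ) + 1 / 2) ^ s) ^ 2 = ((l : ℝ) + 1 / 2) ^ (2 * s) := by
      rw [← Real.rpow_natCast, ← Real.rpow_mul (by positivity)]
      congr 1
      push_cast; ring
    rw [mul_pow, h3, ← mul_assoc]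
    refine le_mul_of_one_le_left (sq_nonneg _) ?_
    exact h2.symm.le.trans (by gcongr)

/-! ### The majorant at the thresholds of the algorithm -/

/-- Since log ℓ is of order at most |log δ|, the left side is at most c₃ m^(ν+1/2) η. Below the
cut-off m^(ν+1/2) ≤ √c₀/η because γ(ν + 1/2) ≤ 1, and c₀ = (1 + c₃)⁻² leaves c₃/(1 + c₃). -/
theorem two_mul_opThreshold_lt_one {lam ν s κ δ η q₀ c₀ : ℝ} {l : ℕ} (hs : 1 / 2 < s)
    (hlam : 0 < lam) (hν : 0 ≤ ν) (hκ : 0 ≤ κ) (hq₀ : 0 ≤ q₀) (hη : 0 < η) (hη1 : η ≤ 1)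
    (hδ : 0 < δ) (hδ1 : δ ≤ 1 / 2) (hδη : operatorSize δ ≤ η)
    (hl : (l : ℝ) ≤ lam * η ^ (-1 / (ν + 1)))
    (hc₀ : c₀ = ((1 + 2 * q₀ * κ * √(2 * Real.log (2 * lam + 1) + 1)) ^ 2)⁻¹)
    (hlow : max (l : ℝ) 1 < c₀ * η ^ (-(2 / (2 * (s + ν) + 1)))) :
    2 * (q₀ * max (l : ℝ) 1 ^ ν) * opThreshold κ δ l < 1 := by
  set m := max (l : ℝ) 1 with hm
  have hm1 : 1 ≤ m := le_max_right _ _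
  set c := 2 * Real.log (2 * lam + 1) + 1 with hc
  have hc0 : 0 ≤ c := by
    have : 0 ≤ Real.log (2 * lam + 1) := Real.log_nonneg (by linarith)
    positivity
  set c₃ := 2 * q₀ * κ * √c with hc₃
  have hc₃0 : 0 ≤ c₃ := by positivity
  have hlog := log_max_two_le hlam hν hη hη1 hδ hδ1
    ((le_two_mul_operatorSize hδ hδ1).trans (by linarith)) hl
  have hO : opThreshold κ δ l ≤ κ * √c * √m * η := by
    have h1 : √(m * Real.log (max (l : ℝ) 2)) ≤ √m * (√c * √|Real.log δ|) := by
      rw [← Real.sqrt_mul hc0, ← Real.sqrt_mul (by positivity)]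
      exact Real.sqrt_le_sqrt (mul_le_mul_of_nonneg_left hlog (by positivity))
    calc opThreshold κ δ l = κ * √(m * Real.log (max (l : ℝ) 2)) * (δ * √|Real.log δ|) := rfl
      _ ≤ κ * (√m * (√c * √|Real.log δ|)) * (δ * √|Real.log δ|) := by gcongr
      _ = κ * √c * √m * (δ * (√|Real.log δ| * √|Real.log δ|)) := by ring
      _ = κ * √c * √m * operatorSize δ := by
          rw [Real.mul_self_sqrt (abs_nonneg _), operatorSize]
      _ ≤ _ := by gcongr
  have hc₀0 : 0 < c₀ := by rw [hc₀]; positivity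
  have hc₀1 : c₀ ≤ 1 := by
    rw [hc₀]
    exact inv_le_one_of_one_le₀ (one_le_pow₀ (by linarith))
  have hpow : m ^ (ν + 1 / 2) ≤ (1 + c₃)⁻¹ * η⁻¹ := by
    calc m ^ (ν + 1 / 2) ≤ (c₀ * η ^ (-(2 / (2 * (s + ν) + 1)))) ^ (ν + 1 / 2) := by
          gcongr
      _ = c₀ ^ (ν + 1 / 2) * η ^ (-(2 / (2 * (s + ν) + 1)) * (ν + 1 / 2)) := by
          rw [Real.mul_rpow hc₀0.le (by positivity), ← Real.rpow_mul hη.le]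
      _ ≤ c₀ ^ (1 / 2 : ℝ) * η ^ (-1 : ℝ) := by
          refine mul_le_mul ?_ ?_ (by positivity) (by positivity)
          · exact Real.rpow_le_rpow_of_exponent_ge hc₀0 hc₀1 (by linarith)
          · refine Real.rpow_le_rpow_of_exponent_ge hη hη1 ?_
            rw [neg_mul, neg_le_neg_iff, div_mul_eq_mul_div, div_le_one (by positivity)]
            linarith
      _ = _ := by
          rw [← Real.sqrt_eq_rpow, hc₀, Real.sqrt_inv, Real.sqrt_sq (by positivity),
            Real.rpow_neg_one]
  calc 2 * (q₀ * m ^ ν) * opThreshold κ δ l ≤ 2 * (q₀ * m ^ ν) * (κ * √c * √m * η) := by gcongr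
    _ = c₃ * (m ^ (ν + 1 / 2)) * η := by
        rw [Real.rpow_add (by positivity), ← Real.sqrt_eq_rpow]; ring
    _ ≤ c₃ * ((1 + c₃)⁻¹ * η⁻¹) * η := by gcongr
    _ = c₃ / (1 + c₃) := by field_simp
    _ < 1 := by rw [div_lt_one (by positivity)]; linarith

/-- The first-order term accounts for S/8 by the choice of its bound. In the remainder β² supplies a
factor m, and m^(ν+1) ≤ p/η cancels one power of δ|log δ|, leaving another S/8. -/
theorem operator_error_le {τ δ lb Lg m ν q₀ M₁ c p η β : ℝ} (hδ : 0 < δ) (hm : 1 ≤ m)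
    (hlb : 0 < lb) (hLg : 0 ≤ Lg) (hη : 0 < η) (hq₀ : 0 < q₀) (hM₁ : 0 < M₁) (hc : 0 ≤ c)
    (hp : 0 < p) (hδη : δ * lb ≤ η) (hLgc : Lg ≤ c * lb) (hmp : m ^ (ν + 1) ≤ p / η)
    (hβ : β ^ 2 = 1024 * (m * Lg) * lb) (hτ : 16384 * (q₀ ^ 2 * M₁ * c * p) ≤ τ) :
    δ * (τ / 8 * (m ^ ν * lb) + δ * (q₀ * m ^ ν * β ^ 2 * (2 * (q₀ * m ^ ν)) * M₁)) ≤
      m ^ ν * (τ * (δ * lb)) / 4 := by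
  have hm0 : 0 < m := by linarith
  have h2 : δ * (m ^ (ν + 1) * Lg) ≤ c * p := by
    calc δ * (m ^ (ν + 1) * Lg) ≤ δ * (p / η * (c * lb)) := by gcongr
      _ = c * p * (δ * lb / η) := by ring
      _ ≤ c * p * 1 := by
          gcongr
          exact (div_le_one hη).2 hδη
      _ = _ := mul_one _
  have h3 : δ * (δ * (q₀ * m ^ ν * β ^ 2 * (2 * (q₀ * m ^ ν)) * M₁)) ≤
      m ^ ν * (τ * (δ * lb)) / 8 := by
    calc _ = 2048 * (q₀ ^ 2 * M₁) * (δ * ((m ^ ν * m) * Lg)) * (m ^ ν * (δ * lb)) := by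
          rw [hβ]; ring
      _ = 2048 * (q₀ ^ 2 * M₁) * (δ * (m ^ (ν + 1) * Lg)) * (m ^ ν * (δ * lb)) := by
          rw [Real.rpow_add_one hm0.ne']
      _ ≤ 2048 * (q₀ ^ 2 * M₁) * (c * p) * (m ^ ν * (δ * lb)) := by gcongr
      _ = 16384 * (q₀ ^ 2 * M₁ * c * p) * (m ^ ν * (δ * lb)) / 8 := by ring
      _ ≤ τ * (m ^ ν * (δ * lb)) / 8 := by gcongr
      _ = _ := by ring
  linarith

/-- The second moments cost at most δ⁻³, so the weight t = δ⁶ is more than enough. -/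
theorem moment_term_le {M₁ Λ δ C x : ℝ} (hδ : 0 < δ) (hδ1 : δ ≤ 1) (hΛ : 0 < Λ) (hx : 0 ≤ x)
    (hxΛ : x ≤ Λ / δ) :
    3 * δ ^ 6 * (M₁ ^ 2 + M₁ ^ 2 * x * (x * (4 * Real.exp (1 / 2))) +
      δ⁻¹ ^ 2 * (x * (4 * Real.exp (C / 2)))) ≤
      3 * (M₁ ^ 2 + M₁ ^ 2 * Λ ^ 2 * (4 * Real.exp (1 / 2)) + Λ * (4 * Real.exp (C / 2))) *
        δ ^ 2 := by
  have hδi : 1 ≤ δ⁻¹ := (one_le_inv₀ hδ).2 hδ1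
  have h1 : δ ^ 3 ≤ δ ^ 2 := pow_le_pow_of_le_one hδ.le hδ1 (by norm_num)
  rw [div_eq_mul_inv] at hxΛ
  have ha : M₁ ^ 2 ≤ M₁ ^ 2 * (δ⁻¹) ^ 3 :=
    le_mul_of_one_le_right (by positivity) (one_le_pow₀ hδi)
  have hb : M₁ ^ 2 * x * (x * (4 * Real.exp (1 / 2))) ≤
      M₁ ^ 2 * (Λ * δ⁻¹) * ((Λ * δ⁻¹) * (4 * Real.exp (1 / 2))) * δ⁻¹ := by
    refine le_trans ?_ (le_mul_of_one_le_right (by positivity) hδi)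
    gcongr
  have hc : δ⁻¹ ^ 2 * (x * (4 * Real.exp (C / 2))) ≤
      δ⁻¹ ^ 2 * ((Λ * δ⁻¹) * (4 * Real.exp (C / 2))) := by gcongr
  calc _ ≤ 3 * δ ^ 6 * (M₁ ^ 2 * (δ⁻¹) ^ 3 + M₁ ^ 2 * (Λ * δ⁻¹) *
        ((Λ * δ⁻¹) * (4 * Real.exp (1 / 2))) * δ⁻¹ +
        δ⁻¹ ^ 2 * ((Λ * δ⁻¹) * (4 * Real.exp (C / 2)))) :=
        mul_le_mul_of_nonneg_left (add_le_add (add_le_add ha hb) hc) (by positivity)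
    _ = 3 * (M₁ ^ 2 + M₁ ^ 2 * Λ ^ 2 * (4 * Real.exp (1 / 2)) + Λ * (4 * Real.exp (C / 2))) *
      δ ^ 3 := by field_simp
    _ ≤ _ := by gcongr

/-- Both exponents are at least 32|log δ|, so both tails are at most δ³², which beats δ⁻⁶ from 1/t
and δ⁻¹ from the level. -/
theorem operator_tail_le {Λ δ x m Lg α β V : ℝ} (hδ : 0 < δ) (hδ1 : δ ≤ 1 / 2) (hΛ : 0 < Λ)
    (hx : 0 < x) (hxΛ : x ≤ Λ / δ) (hxm : x ≤ 2 * m) (hLg : 1 / 2 ≤ Lg)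
    (hβ : β ^ 2 = 1024 * (m * Lg) * |Real.log δ|) (hV : 0 < V) (hα : 16 * V * |Real.log δ| ≤ α) :
    (δ ^ 6)⁻¹ * (8 * x * Real.exp (-β ^ 2 / (8 * x)) + 2 * Real.exp (-α ^ 2 / (2 * V ^ 2))) ≤
      (8 * Λ + 2) * δ ^ 2 := by
  have hlb := half_le_abs_log hδ hδ1
  have e₀ := exp_neg_mul_abs_log hδ hδ1 32
  set lb := |Real.log δ|
  have e₁ : Real.exp (-β ^ 2 / (8 * x)) ≤ δ ^ 32 := by
    rw [← e₀]
    refine Real.exp_le_exp.2 ?_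
    rw [neg_div, neg_le_neg_iff, le_div_iff₀ (by positivity), hβ]
    push_cast
    have h1 : (1 : ℝ) / 2 * (x / 2) ≤ Lg * m := by
      gcongr
      linarith
    have h2 := mul_le_mul_of_nonneg_right h1 (by linarith : 0 ≤ lb)
    linarith
  have e₂ : Real.exp (-α ^ 2 / (2 * V ^ 2)) ≤ δ ^ 32 := by
    rw [← e₀]
    refine Real.exp_le_exp.2 ?_
    rw [neg_div, neg_le_neg_iff, le_div_iff₀ (by positivity)]
    push_cast
    calc 32 * lb * (2 * V ^ 2) ≤ 256 * V ^ 2 * (lb * lb) := by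
          have h1 : 1 / 2 * lb ≤ lb * lb := mul_le_mul_of_nonneg_right hlb (by linarith)
          have h2 := mul_le_mul_of_nonneg_left h1 (sq_nonneg V)
          have h3 : 0 ≤ V ^ 2 * lb := by positivity
          linarith
      _ = (16 * V * lb) ^ 2 := by ring
      _ ≤ α ^ 2 := by gcongr
  have hδi : 1 ≤ δ⁻¹ := (one_le_inv₀ hδ).2 (by linarith)
  have h25 : δ ^ 25 ≤ δ ^ 2 := pow_le_pow_of_le_one hδ.le (by linarith) (by norm_num)
  calc _ ≤ (δ ^ 6)⁻¹ * (8 * (Λ / δ) * δ ^ 32 + 2 * δ⁻¹ * δ ^ 32) := by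
        gcongr
        linarith
    _ = (8 * Λ + 2) * δ ^ 25 := by field_simp
    _ ≤ _ := by gcongr

/-- With u = √|log ε|/m^ν all powers of m cancel in the exponents: the gain is at least (τ/4)|log
ε|, the Gaussian cost is 8Cq₀²|log ε|, and the condition on τ leaves ε². -/
theorem signal_tail_le {M₁ C τ ε m ν q₀ p η S : ℝ} (hε : 0 < ε) (hε1 : ε ≤ 1 / 2) (hM₁ : 0 < M₁)
    (hm : 1 ≤ m) (hη : signalSize ε ≤ η) (hp : 0 < p) (hmp : m ^ (ν + 1) ≤ p / η)
    (hS : m ^ ν * (τ * signalSize ε) ≤ S) (hτ : 4 * (8 * C * q₀ ^ 2 + 2) ≤ τ) :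
    (M₁ + 2 * ε / (√|Real.log ε| / m ^ ν)) *
      Real.exp (-(√|Real.log ε| / m ^ ν * S / (4 * ε))) *
      (2 * Real.exp (C * (2 * (q₀ * m ^ ν)) ^ 2 * (2 * (√|Real.log ε| / m ^ ν)) ^ 2 / 2)) ≤
      2 * (M₁ + 4 * p) * ε ^ 2 := by
  have hL := half_le_abs_log hε hε1
  have hss := signalSize_pos hε hε1
  have e₀ := exp_neg_mul_abs_log hε hε1 2
  rw [signalSize] at hη hS hss
  set L := |Real.log ε|
  have hL0 : 0 < L := by linarith
  have hsq : √L ^ 2 = L := Real.sq_sqrt hL0.le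
  have hsL : 0 < √L := Real.sqrt_pos.2 hL0
  have hmν : 0 < m ^ ν := Real.rpow_pos_of_pos (by linarith) _
  set u := √L / m ^ ν with hu
  have hu0 : 0 < u := by positivity
  have h1 : ε / u ≤ 2 * p := by
    have hm2 : m ^ ν ≤ p / (ε * √L) := by
      refine (Real.rpow_le_rpow_of_exponent_le hm (by linarith)).trans (hmp.trans ?_)
      gcongr
    calc ε / u = ε * m ^ ν / √L := by rw [hu]; field_simp
      _ ≤ ε * (p / (ε * √L)) / √L := by gcongr
      _ = p / √L ^ 2 := by field_simp
      _ = p / L := by rw [hsq]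
      _ ≤ 2 * p := by
          rw [div_le_iff₀ hL0]
          have := mul_le_mul_of_nonneg_left hL hp.le
          linarith
  have h2 : τ / 4 * L ≤ u * S / (4 * ε) := by
    rw [le_div_iff₀ (by positivity)]
    calc τ / 4 * L * (4 * ε) = τ / 4 * √L ^ 2 * (4 * ε) := by rw [hsq]
      _ = u * (m ^ ν * (τ * (ε * √L))) := by
          rw [hu]
          field_simp
      _ ≤ u * S := by gcongr
  have h3 : C * (2 * (q₀ * m ^ ν)) ^ 2 * (2 * u) ^ 2 / 2 = 8 * C * q₀ ^ 2 * L := by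
    conv_rhs => rw [← hsq]
    rw [hu]
    field_simp
    ring
  have h4 : Real.exp (-(u * S / (4 * ε))) *
      Real.exp (C * (2 * (q₀ * m ^ ν)) ^ 2 * (2 * u) ^ 2 / 2) ≤ ε ^ 2 := by
    rw [← Real.exp_add, ← e₀, h3]
    refine Real.exp_le_exp.2 ?_
    push_cast
    have := mul_le_mul_of_nonneg_right hτ hL0.le
    linarith
  calc _ = 2 * (M₁ + 2 * (ε / u)) * (Real.exp (-(u * S / (4 * ε))) *
        Real.exp (C * (2 * (q₀ * m ^ ν)) ^ 2 * (2 * u) ^ 2 / 2)) := by ring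
    _ ≤ 2 * (M₁ + 2 * (2 * p)) * ε ^ 2 := by gcongr
    _ = _ := by ring

/-- The constant in `exists_level_majorant`. -/
noncomputable def majorantConst (lam ν M₁ C : ℝ) : ℝ :=
  3 * (M₁ ^ 2 + M₁ ^ 2 * (2 * lam + 1) ^ 2 * (4 * Real.exp (1 / 2)) +
    (2 * lam + 1) * (4 * Real.exp (C / 2))) + (8 * (2 * lam + 1) + 2) +
    2 * (M₁ + 4 * (lam ^ (ν + 1) + 1))

theorem exists_level_majorant {Ω : Type*} [MeasurableSpace Ω] {P : Measure Ω}
    [IsProbabilityMeasure P] {b : ℕ → Ω → ℝ} {l : ℕ} {ξ : Ω → EuclideanSpace ℝ (Fin (l + 1))}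
    (hlaw : ∀ k, HasLaw (b k) (gaussianReal 0 1) P) (hind : iIndepFun b P)
    {Γ : Matrix (Fin (l + 1)) (Fin (l + 1)) ℝ} (hΓ : Γ.PosSemidef) {C : ℝ} (hC : 0 ≤ C)
    (hspec : ∀ μ ∈ spectrum ℝ Γ, μ ≤ C) (hξ : HasLaw ξ (multivariateGaussian 0 Γ) P)
    (hbξ : IndepFun (fun ω k => b k ω) ξ P)
    {lam ν κ τsig τop δ ε M₁ q₀ : ℝ} (hlam : 0 < lam) (hν : 0 ≤ ν)
    (hM₁ : 0 < M₁) (hq₀ : 0 < q₀) (hκ : 64 ≤ κ) (hτsig : 4 * (8 * C * q₀ ^ 2 + 2) ≤ τsig)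
    (hτop : 128 * (M₁ * q₀) ≤ τop)
    (hτop' : 16384 * (q₀ ^ 2 * M₁ * (2 * Real.log (2 * lam + 1) + 1) * (lam ^ (ν + 1) + 1)) ≤ τop)
    (hδ : 0 < δ) (hδ1 : δ ≤ 1 / 2) (hε : 0 < ε) (hε1 : ε ≤ 1 / 2)
    (hl : (l : ℝ) ≤ maxLevel lam ν ε δ)
    {K : Matrix (Fin (l + 1)) (Fin (l + 1)) ℝ} (hK : IsUnit K)
    (hq : opNorm K⁻¹ ≤ q₀ * max (l : ℝ) 1 ^ ν)
    {f : Fin (l + 1) → ℝ} (hf : ∑ j, |f j| ≤ M₁) {low : Prop} [Decidable low]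
    (hlow : low → 2 * (q₀ * max (l : ℝ) 1 ^ ν) * opThreshold κ δ l < 1) :
    ∃ G : Ω → ℝ≥0∞, AEMeasurable G P ∧
      ∫⁻ ω, G ω ∂P ≤ ENNReal.ofReal (majorantConst lam ν M₁ C * (δ ^ 2 + ε ^ 2)) ∧
      ∀ ω, ENNReal.ofReal |(if sigThreshold ν τsig τop ε δ l <
              |zeta κ δ l (K + δ • toeplitz (fun k => b k ω) l)
              (K.mulVec f + ε • (ξ ω).ofLp)| then
            zeta κ δ l (K + δ • toeplitz (fun k => b k ω) l) (K.mulVec f + ε • (ξ ω).ofLp)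
          else 0) - f (Fin.last l)| ≤
        ENNReal.ofReal (if low then 3 / 2 * sigThreshold ν τsig τop ε δ l
          else |f (Fin.last l)|) + G ω := by
  have hδos := le_two_mul_operatorSize hδ hδ1
  have hos0 := operatorSize_pos hδ hδ1
  have hη1 : max (signalSize ε) (operatorSize δ) ≤ 1 :=
    max_le (signalSize_le_one hε hε1) (operatorSize_le_one hδ hδ1)
  have hosη : operatorSize δ ≤ max (signalSize ε) (operatorSize δ) := le_max_right _ _
  have hssη : signalSize ε ≤ max (signalSize ε) (operatorSize δ) := le_max_left _ _
  rw [maxLevel] at hl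
  generalize max (signalSize ε) (operatorSize δ) = η at hη1 hosη hssη hl
  have hη : 0 < η := hos0.trans_le hosη
  have hlδ := level_add_one_le hlam hν hη hη1 hδ hδ1 (hδos.trans (by linarith)) hl
  have hlog := log_max_two_le hlam hν hη hη1 hδ hδ1 (hδos.trans (by linarith)) hl
  have hmpow := max_rpow_le hlam hν hη hη1 (Nat.cast_nonneg l) hl
  have hlb := half_le_abs_log hδ hδ1
  have hLg : 1 / 2 ≤ Real.log (max (l : ℝ) 2) := by
    have h1 : Real.log 2 ≤ Real.log (max (l : ℝ) 2) := Real.log_le_log two_pos (le_max_right _ _)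
    linarith [Real.log_two_gt_d9]
  have hm1 : 1 ≤ max (l : ℝ) 1 := le_max_right _ _
  have hml : ((l : ℝ) + 1) ≤ 2 * max (l : ℝ) 1 := by
    have : (l : ℝ) ≤ max (l : ℝ) 1 := le_max_left _ _
    linarith
  have hSop : max (l : ℝ) 1 ^ ν * (τop * (δ * |Real.log δ|)) ≤
      sigThreshold ν τsig τop ε δ l := by
    rw [sigThreshold]
    gcongr
    exact le_max_right _ _
  have hSsig : max (l : ℝ) 1 ^ ν * (τsig * signalSize ε) ≤ sigThreshold ν τsig τop ε δ l := by
    rw [sigThreshold]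
    gcongr
    exact le_max_left _ _
  -- Here β is the norm level 32√(m log(ℓ ∨ 2)|log δ|), with m = ℓ ∨ 1; κ ≥ 64 is what makes δβ ≤
  -- O/2.
  have hOβ : opThreshold κ δ l / 2 = κ / 64 * (δ * (32 *
      √(max (l : ℝ) 1 * Real.log (max (l : ℝ) 2)) * √|Real.log δ|)) := by
    rw [opThreshold]; ring
  have hp : 0 < lam ^ (ν + 1) + 1 := by positivity
  have hc : 0 ≤ 2 * Real.log (2 * lam + 1) + 1 := by
    have : 0 ≤ Real.log (2 * lam + 1) := Real.log_nonneg (by linarith)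
    positivity
  have hτop0 : 0 < τop := lt_of_lt_of_le (by positivity) hτop
  have hβ2 : (32 * √(max (l : ℝ) 1 * Real.log (max (l : ℝ) 2)) * √|Real.log δ|) ^ 2 =
      1024 * (max (l : ℝ) 1 * Real.log (max (l : ℝ) 2)) * |Real.log δ| := by
    rw [mul_pow, mul_pow, Real.sq_sqrt (by positivity), Real.sq_sqrt (by positivity)]
    ring
  have hβ0 : 0 ≤ 32 * √(max (l : ℝ) 1 * Real.log (max (l : ℝ) 2)) * √|Real.log δ| := by positivity
  generalize 32 * √(max (l : ℝ) 1 * Real.log (max (l : ℝ) 2)) * √|Real.log δ| = β at hOβ hβ2 hβ0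
  generalize sigThreshold ν τsig τop ε δ l = S at hSop hSsig
  generalize Real.log (max (l : ℝ) 2) = Lg at hlog hLg hβ2
  generalize max (l : ℝ) 1 = m at hmpow hm1 hml hSop hSsig hβ2 hq hlow
  have hm0 : 0 < m := by linarith
  have hβ1 : 1 ≤ β := by
    refine (one_le_sq_iff₀ hβ0).1 ?_
    rw [hβ2]
    have : 1 * (1 / 2) * (1 / 2) ≤ m * Lg * |Real.log δ| := by gcongr
    linarith
  have hβO : δ * β ≤ opThreshold κ δ l / 2 := by
    rw [hOβ]
    exact le_mul_of_one_le_left (by positivity) (by linarith)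
  have hO : δ ≤ opThreshold κ δ l := by
    have := le_mul_of_one_le_right hδ.le hβ1
    linarith
  have hεL := half_le_sqrt_abs_log hε hε1
  have hαS := (operator_error_le (τ := τop) hδ hm1 (by linarith) (by linarith) hη hq₀ hM₁ hc hp hosη
    hlog hmpow hβ2 (by linarith)).trans (div_le_div_of_nonneg_right hSop (by norm_num))
  obtain ⟨G, hGm, hGi, hG⟩ := exists_majorant hlaw hind hΓ hC hspec hξ hbξ (κ := κ) (S := S)
    (α := τop / 8 * (m ^ ν * |Real.log δ|)) (u := √|Real.log ε| / m ^ ν)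
    (V := ((M₁ * (q₀ * m ^ ν)) ^ 2).toNNReal) (t := δ ^ 6) hδ hε (by linarith) hO
    (by positivity) hβ0 (by positivity) (by positivity) hK hq hf
    (by rw [Real.coe_toNNReal _ (by positivity)]) hβO hαS hlow
  refine ⟨G, hGm, hGi.trans (ENNReal.ofReal_le_ofReal ?_), hG⟩
  rw [Real.coe_toNNReal _ (by positivity)]
  have hT₁ := moment_term_le (M₁ := M₁) (C := C) hδ (by linarith) (by positivity) (by positivity) hlδ
  have hT₂ := operator_tail_le (V := M₁ * (q₀ * m ^ ν)) (α := τop / 8 * (m ^ ν * |Real.log δ|))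
    hδ hδ1 (by positivity) (by positivity) hlδ hml hLg hβ2 (by positivity) (by
      calc _ = 128 * (M₁ * q₀) / 8 * (m ^ ν * |Real.log δ|) := by ring
        _ ≤ _ := by gcongr)
  have hT₃ := signal_tail_le hε hε1 hM₁ hm1 hssη hp hmpow hSsig hτsig
  refine (add_le_add (add_le_add hT₁ hT₂) hT₃).trans ?_
  rw [majorantConst]
  have h8 : 0 ≤ 2 * (M₁ + 4 * (lam ^ (ν + 1) + 1)) * δ ^ 2 := by positivity
  have h9 : 0 ≤ (3 * (M₁ ^ 2 + M₁ ^ 2 * (2 * lam + 1) ^ 2 * (4 * Real.exp (1 / 2)) +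
    (2 * lam + 1) * (4 * Real.exp (C / 2))) + (8 * (2 * lam + 1) + 2)) * ε ^ 2 := by positivity
  linarith

/-! ### The risk of the algorithm -/

theorem algorithmI_eq_sum (lam κ τsig τop ν ε δ : ℝ)
    (A : (l : ℕ) → Matrix (Fin (l + 1)) (Fin (l + 1)) ℝ) (y : (l : ℕ) → Fin (l + 1) → ℝ) (x : ℝ) :
    algorithmI lam κ τsig τop ν ε δ A y x =
      ∑ l ∈ Finset.range (⌊maxLevel lam ν ε δ⌋₊ + 1),
        (if sigThreshold ν τsig τop ε δ l < |zeta κ δ l (A l) (y l)| then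
          zeta κ δ l (A l) (y l) else 0) * laguerreFun l x := by
  rw [algorithmI]
  refine Finset.sum_congr rfl fun l _ => ?_
  split_ifs
  · rfl
  · rw [zero_mul]

/-- If the coefficient errors are at most `D_l` plus a random `G_l`, then the `L²` error is at most
the `ℓ²` size of `D` plus the sum of the `G_l`, up to constants. -/
theorem eLpNorm_sum_sub_le_add {f : ℝ → ℝ} (hf : MemLp f 2 halfLine) (s : Finset ℕ) (a : ℕ → ℝ)
    {d D : ℕ → ℝ} {H B : ℝ} {G : ℕ → ℝ≥0∞} (hd : HasSum d H) (hd0 : ∀ l, 0 ≤ d l)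
    (hB : 0 ≤ B) (hH : H ≤ B ^ 2) (hD0 : ∀ l, 0 ≤ D l) (hD : ∀ l ∈ s, D l ^ 2 ≤ d l)
    (htail : ∀ l ∉ s, coeff f l ^ 2 ≤ d l)
    (hG : ∀ l ∈ s, ENNReal.ofReal |a l - coeff f l| ≤ ENNReal.ofReal (D l) + G l) :
    eLpNorm (fun x => ∑ k ∈ s, a k * laguerreFun k x - f x) 2 halfLine ≤
      ENNReal.ofReal (2 * B) + 2 * ∑ l ∈ s, G l := by
  -- The excess of the coefficient error over its deterministic bound.
  set e : ℕ → ℝ := fun l => max (|a l - coeff f l| - D l) 0 with he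
  have he0 : ∀ l, 0 ≤ e l := fun l => le_max_right _ _
  have heG : ∀ l ∈ s, ENNReal.ofReal (e l) ≤ G l := fun l hl => by
    have h1 : ENNReal.ofReal (e l) = ENNReal.ofReal (|a l - coeff f l| - D l) := by
      simp [he, ENNReal.ofReal_max]
    rw [h1, ENNReal.ofReal_sub _ (hD0 l), tsub_le_iff_left]
    exact hG l hl
  have hes : HasSum (fun l => if l ∈ s then 2 * e l ^ 2 else 0) (∑ l ∈ s, 2 * e l ^ 2) := by
    have := hasSum_sum_of_ne_finset_zero (f := fun l => if l ∈ s then 2 * e l ^ 2 else 0) (s := s)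
      (L := SummationFilter.unconditional ℕ) fun l hl => if_neg hl
    rwa [Finset.sum_congr rfl fun l hl => if_pos hl] at this
  have hsum := (hd.mul_left 2).add hes
  refine (eLpNorm_sum_sub_le hf s a hsum fun l => ?_).trans ?_
  · by_cases hl : l ∈ s
    · rw [if_pos hl, if_pos hl]
      have h1 : |a l - coeff f l| ≤ D l + e l := by
        have := le_max_left (|a l - coeff f l| - D l) 0
        simp only [he]
        linarith
      calc (a l - coeff f l) ^ 2 = |a l - coeff f l| ^ 2 := (sq_abs _).symm
        _ ≤ (D l + e l) ^ 2 := by gcongr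
        _ ≤ 2 * D l ^ 2 + 2 * e l ^ 2 := by nlinarith [sq_nonneg (D l - e l)]
        _ ≤ _ := by
            have := hD l hl
            gcongr
    · rw [if_neg hl, if_neg hl, zero_sub, neg_sq, add_zero]
      linarith [htail l hl, hd0 l]
  · calc _ ≤ ENNReal.ofReal (2 * B + 2 * ∑ l ∈ s, e l) := by
          refine ENNReal.ofReal_le_ofReal ?_
          have hE : 0 ≤ ∑ l ∈ s, e l := Finset.sum_nonneg fun l _ => he0 l
          refine Real.sqrt_le_iff.2 ⟨by positivity, ?_⟩
          -- Bounding the ℓ² norm of the excess by its ℓ¹ norm makes the bound linear in G, so only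
          -- first moments of G are needed.
          have h1 : ∑ l ∈ s, e l ^ 2 ≤ (∑ l ∈ s, e l) ^ 2 :=
            Finset.sum_sq_le_sq_sum_of_nonneg fun l _ => he0 l
          rw [← Finset.mul_sum]
          nlinarith [mul_nonneg hB hE]
      _ = ENNReal.ofReal (2 * B) + 2 * ∑ l ∈ s, ENNReal.ofReal (e l) := by
          have hE : 0 ≤ ∑ l ∈ s, e l := Finset.sum_nonneg fun l _ => he0 l
          rw [ENNReal.ofReal_add (by positivity) (by positivity), ENNReal.ofReal_mul two_pos.le,
            ENNReal.ofReal_mul (p := 2) two_pos.le,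
            ENNReal.ofReal_sum_of_nonneg fun l _ => he0 l, ENNReal.ofReal_ofNat]
      _ ≤ _ := by
          gcongr with l hl
          exact heG l hl

theorem rpow_le_rateI {s ν ε δ : ℝ} :
    max (signalSize ε) (operatorSize δ) ^ (2 * s / (2 * (s + ν) + 1)) ≤ rateI s ν ε δ := by
  rcases max_choice (signalSize ε) (operatorSize δ) with h | h
  · rw [h]; exact le_max_right _ _
  · rw [h]; exact le_max_left _ _

/-- The risk bound for one target function, under the numerical conditions on the thresholds. -/
theorem riskI_le {s M ν lam C κ τsig τop δ M₁ q₀ c₀ c₁ σ T : ℝ} {n : ℕ} {t : Fin n → ℝ}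
    (hs : 1 / 2 < s) (hM : 0 ≤ M) (hν : 0 ≤ ν)
    (hlam : 0 < lam) (hC : 0 ≤ C) (hM₁ : sobolevSumBound s M < M₁) (hq₀ : 0 < q₀) (hκ : 64 ≤ κ)
    (hτsig : 4 * (8 * C * q₀ ^ 2 + 2) ≤ τsig) (hτop : 128 * (M₁ * q₀) ≤ τop)
    (hτop' : 16384 * (q₀ ^ 2 * M₁ * (2 * Real.log (2 * lam + 1) + 1) * (lam ^ (ν + 1) + 1)) ≤ τop)
    (hc₀ : c₀ = ((1 + 2 * q₀ * κ * √(2 * Real.log (2 * lam + 1) + 1)) ^ 2)⁻¹)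
    (hc₁ : c₁ = min (c₀ / 2) lam) (hT : 0 < T)
    (hδ : 0 < δ) (hδ1 : δ ≤ 1 / 2) (hε : 0 < noiseLevel σ T n) (hε1 : noiseLevel σ T n ≤ 1 / 2)
    (hwell : WellConditioned T t (maxLevel lam ν (noiseLevel σ T n) δ) C)
    {Ω : Type*} [MeasurableSpace Ω] {P : Measure Ω} [IsProbabilityMeasure P]
    {b : ℕ → Ω → ℝ} {ξ : (l : ℕ) → Ω → EuclideanSpace ℝ (Fin (l + 1))}
    (hnoise : IsNoise P T t (maxLevel lam ν (noiseLevel σ T n) δ) b ξ)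
    {f g : ℝ → ℝ} (hf : f ∈ sobolevBall s M) (hg : g ∈ kernelClass ν q₀) :
    riskI P lam κ τsig τop ν (noiseLevel σ T n) δ b ξ f g ≤ ENNReal.ofReal (
      (2 * √(9 / 2 * (max τsig τop) ^ 2 + c₁ ^ (-(2 * s)) * M ^ 2) +
        8 * (majorantConst lam ν M₁ C * (2 * lam + 1))) * rateI s ν (noiseLevel σ T n) δ) := by
  set ε := noiseLevel σ T n
  have hM₁0 : 0 < M₁ := lt_of_le_of_lt (by rw [sobolevSumBound]; positivity) hM₁
  have hδos := le_two_mul_operatorSize hδ hδ1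
  have hεss := le_two_mul_signalSize hε hε1
  have hos0 := operatorSize_pos hδ hδ1
  have hss0 := signalSize_pos hε hε1
  set η := max (signalSize ε) (operatorSize δ) with hηdef
  have hη : 0 < η := hos0.trans_le (le_max_right _ _)
  have hη1 : η ≤ 1 := max_le (signalSize_le_one hε hε1) (operatorSize_le_one hδ hδ1)
  have hosη : operatorSize δ ≤ η := le_max_right _ _
  have hssη : signalSize ε ≤ η := le_max_left _ _
  have hL : maxLevel lam ν ε δ = lam * η ^ (-1 / (ν + 1)) := rfl
  set L := maxLevel lam ν ε δ
  have hL0 : 0 ≤ L := by rw [hL]; positivity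
  set γ := 2 / (2 * (s + ν) + 1) with hγ
  have hγ0 : 0 < γ := by positivity
  have hx : 0 < η ^ (-γ) := Real.rpow_pos_of_pos hη _
  have hc₀0 : 0 < c₀ := by
    have : 0 ≤ Real.log (2 * lam + 1) := Real.log_nonneg (by linarith)
    rw [hc₀]; positivity
  have hc₀1 : c₀ ≤ 1 := by
    rw [hc₀]
    refine inv_le_one_of_one_le₀ (one_le_pow₀ ?_)
    have : 0 ≤ 2 * q₀ * κ * √(2 * Real.log (2 * lam + 1) + 1) := by positivity
    linarith
  have hc₁0 : 0 < c₁ := by rw [hc₁]; positivity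
  have hτop0 : 0 < τop := lt_of_lt_of_le (by positivity) hτop
  have hτ0 : 0 < max τsig τop := hτop0.trans_le (le_max_right _ _)
  obtain ⟨d, H, hd, hH, hd0, hdlow, hdhigh⟩ :=
    exists_hasSum_bias_variance (τ := max τsig τop) hs hν hτ0.le hη hη1 hγ hc₁0 hf
  have hS0 : ∀ l, 0 ≤ sigThreshold ν τsig τop ε δ l := fun l => by
    rw [sigThreshold]
    exact mul_nonneg (by positivity) (le_max_of_le_right (by positivity))
  have hSle : ∀ l, sigThreshold ν τsig τop ε δ l ≤
      max (l : ℝ) 1 ^ ν * (max τsig τop * η) := fun l => by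
    rw [sigThreshold]
    gcongr
    exact max_le (mul_le_mul (le_max_left _ _) hssη hss0.le hτ0.le)
      (mul_le_mul (le_max_right _ _) hosη hos0.le hτ0.le)
  classical
  -- Low levels lie below c₀η^(−γ), where acceptance is certain on the good event. Above them l +
  -- 1/2 ≥ (ℓ ∨ 1)/2 explains c₀/2 in c₁; the bound c₁ ≤ lam serves levels beyond L.
  set D : ℕ → ℝ := fun l => if max (l : ℝ) 1 < c₀ * η ^ (-γ) then
    3 / 2 * sigThreshold ν τsig τop ε δ l else |coeff f l| with hDdef
  have hD0 : ∀ l, 0 ≤ D l := fun l => by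
    simp only [hDdef]
    split_ifs
    · exact mul_nonneg (by norm_num) (hS0 l)
    · exact abs_nonneg _
  have hD : ∀ l, D l ^ 2 ≤ d l := fun l => by
    by_cases hlow : max (l : ℝ) 1 < c₀ * η ^ (-γ)
    · refine le_trans ?_ (hdlow l (hlow.trans_le (mul_le_of_le_one_left hx.le hc₀1)))
      simp only [hDdef, if_pos hlow]
      have := hS0 l
      gcongr
      exact hSle l
    · simp only [hDdef, if_neg hlow, sq_abs]
      refine hdhigh l ?_
      have h1 : c₁ * η ^ (-γ) ≤ c₀ / 2 * η ^ (-γ) := by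
        gcongr
        rw [hc₁]
        exact min_le_left _ _
      have h2 : max (l : ℝ) 1 ≤ 2 * (l + 1 / 2) := by
        have : (0 : ℝ) ≤ l := Nat.cast_nonneg l
        exact max_le (by linarith) (by linarith)
      linarith [not_lt.1 hlow]
  have hmem : ∀ l, l ∈ Finset.range (⌊L⌋₊ + 1) ↔ (l : ℝ) ≤ L := fun l => by
    rw [Finset.mem_range, Nat.lt_succ_iff, Nat.le_floor_iff hL0]
  have htail : ∀ l ∉ Finset.range (⌊L⌋₊ + 1), coeff f l ^ 2 ≤ d l := fun l hl => by
    rw [hmem, not_le] at hl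
    refine hdhigh l ?_
    -- The truncation at L is harmless: γ ≤ 1/(ν + 1) because s ≥ 1/2, so L lies above a multiple of
    -- the cut-off.
    have h1 : η ^ (-γ) ≤ η ^ (-1 / (ν + 1)) := by
      refine Real.rpow_le_rpow_of_exponent_ge hη hη1 ?_
      rw [hγ, neg_div, neg_le_neg_iff, div_le_div_iff₀ (by positivity) (by positivity)]
      linarith
    have h2 : c₁ * η ^ (-γ) ≤ L := by
      rw [hL]
      gcongr
      rw [hc₁]
      exact min_le_right _ _
    linarith
  have hmaj : ∀ l : ℕ, ∃ G : Ω → ℝ≥0∞, AEMeasurable G P ∧ ((l : ℝ) ≤ L →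
      ∫⁻ ω, G ω ∂P ≤ ENNReal.ofReal (majorantConst lam ν M₁ C * (δ ^ 2 + ε ^ 2)) ∧
      ∀ ω, ENNReal.ofReal |(if sigThreshold ν τsig τop ε δ l <
              |zeta κ δ l (noisyOperator g δ (fun k => b k ω) l)
              (noisySignal f g ε (fun l => ξ l ω) l)| then
            zeta κ δ l (noisyOperator g δ (fun k => b k ω) l)
              (noisySignal f g ε (fun l => ξ l ω) l)
          else 0) - coeff f l| ≤ ENNReal.ofReal (D l) + G ω) := by
    intro l
    by_cases hl : (l : ℝ) ≤ L
    · obtain ⟨hK, hq⟩ := hg.2 l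
      obtain ⟨G, h1, h2, h3⟩ := exists_level_majorant hnoise.law_b hnoise.indep_b
        (posSemidef_designCov hT t l) hC (hwell l hl).2 (hnoise.law_ξ l hl) (hnoise.indep_ξ l hl)
        hlam hν hM₁0 hq₀ hκ hτsig hτop hτop' hδ hδ1 hε hε1 hl hK hq
        (f := fun k => coeff f k) ((sum_abs_coeff_le hs hM hf (l + 1)).trans hM₁.le)
        (low := max (l : ℝ) 1 < c₀ * η ^ (-γ))
        (two_mul_opThreshold_lt_one hs hlam hν (by linarith) hq₀.le hη hη1 hδ hδ1 hosη hl hc₀)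
      exact ⟨G, h1, fun _ => ⟨h2, h3⟩⟩
    · exact ⟨0, aemeasurable_const, fun h => absurd h hl⟩
  choose G hGm hG using hmaj
  set B := √(9 / 2 * (max τsig τop) ^ 2 + c₁ ^ (-(2 * s)) * M ^ 2) * η ^ (s * γ) with hBdef
  have hHB : H ≤ B ^ 2 := by
    rw [hBdef, mul_pow, Real.sq_sqrt (by positivity)]
    exact hH
  have hpt : ∀ ω, eLpNorm (fun x => algorithmI lam κ τsig τop ν ε δ
      (noisyOperator g δ (fun k => b k ω)) (noisySignal f g ε (fun l => ξ l ω)) x - f x)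
      2 halfLine ≤ ENNReal.ofReal (2 * B) + 2 * ∑ l ∈ Finset.range (⌊L⌋₊ + 1), G l ω := by
    intro ω
    simp_rw [algorithmI_eq_sum]
    exact eLpNorm_sum_sub_le_add hf.1 _ _ hd hd0 (by positivity) hHB hD0 (fun l _ => hD l) htail
      fun l hl => (hG l ((hmem l).1 hl)).2 ω
  set c := majorantConst lam ν M₁ C with hc
  have hc0 : 0 ≤ c := by rw [hc, majorantConst]; positivity
  rw [riskI]
  calc _ ≤ ∫⁻ ω, (ENNReal.ofReal (2 * B) + 2 * ∑ l ∈ Finset.range (⌊L⌋₊ + 1), G l ω) ∂P :=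
        lintegral_mono hpt
    _ = ENNReal.ofReal (2 * B) + 2 * ∑ l ∈ Finset.range (⌊L⌋₊ + 1), ∫⁻ ω, G l ω ∂P := by
        rw [lintegral_add_left measurable_const, lintegral_const, measure_univ, mul_one,
          lintegral_const_mul' _ _ (by simp), lintegral_finsetSum' _ fun l _ => hGm l]
    _ ≤ ENNReal.ofReal (2 * B) + 2 * ∑ l ∈ Finset.range (⌊L⌋₊ + 1),
          ENNReal.ofReal (c * (δ ^ 2 + ε ^ 2)) := by
        gcongr with l hl
        exact (hG l ((hmem l).1 hl)).1
    _ = ENNReal.ofReal (2 * B + 2 * (((⌊L⌋₊ : ℝ) + 1) * (c * (δ ^ 2 + ε ^ 2)))) := by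
        rw [Finset.sum_const, Finset.card_range, nsmul_eq_mul,
          ENNReal.ofReal_add (by positivity) (by positivity), ENNReal.ofReal_mul (p := 2) two_pos.le,
          ENNReal.ofReal_mul (p := 2) two_pos.le,
          ENNReal.ofReal_mul (p := (⌊L⌋₊ : ℝ) + 1) (by positivity), ENNReal.ofReal_ofNat,
          ← Nat.cast_succ, ENNReal.ofReal_natCast]
    _ ≤ _ := by
        refine ENNReal.ofReal_le_ofReal ?_
        have hN : (⌊L⌋₊ : ℝ) + 1 ≤ L + 1 := by gcongr; exact Nat.floor_le hL0
        have hNδ := hN.trans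
          (level_add_one_le hlam hν hη hη1 hδ hδ1 (hδos.trans (by linarith)) hL.le)
        have hNε := hN.trans
          (level_add_one_le hlam hν hη hη1 hε hε1 (hεss.trans (by linarith)) hL.le)
        rw [le_div_iff₀ hδ] at hNδ
        rw [le_div_iff₀ hε] at hNε
        have hsγ : s * γ = 2 * s / (2 * (s + ν) + 1) := by rw [hγ]; ring
        have hηr : η ≤ η ^ (s * γ) := by
          conv_lhs => rw [← Real.rpow_one η]
          refine Real.rpow_le_rpow_of_exponent_ge hη hη1 ?_
          rw [hsγ, div_le_one (by positivity)]
          linarith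
        have hrate : η ^ (s * γ) ≤ rateI s ν ε δ := by
          rw [hsγ]
          exact rpow_le_rateI
        -- The number of levels is at most (2 lam + 1)/δ and (2 lam + 1)/ε, so one factor δ or ε is
        -- spent and the other is at most 2η.
        have h1 : ((⌊L⌋₊ : ℝ) + 1) * (c * (δ ^ 2 + ε ^ 2)) ≤ 4 * (c * (2 * lam + 1)) * η := by
          calc _ = c * ((((⌊L⌋₊ : ℝ) + 1) * δ) * δ + (((⌊L⌋₊ : ℝ) + 1) * ε) * ε) := by ring
            _ ≤ c * ((2 * lam + 1) * (2 * η) + (2 * lam + 1) * (2 * η)) := by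
                gcongr
                · exact hδos.trans (by linarith)
                · exact hεss.trans (by linarith)
            _ = _ := by ring
        calc _ ≤ 2 * (√(9 / 2 * (max τsig τop) ^ 2 + c₁ ^ (-(2 * s)) * M ^ 2) * η ^ (s * γ)) +
              2 * (4 * (c * (2 * lam + 1)) * η ^ (s * γ)) := by
              have h2 := mul_le_mul_of_nonneg_left hηr
                (show 0 ≤ 4 * (c * (2 * lam + 1)) by positivity)
              rw [hBdef]
              linarith [h1.trans h2]
          _ = (2 * √(9 / 2 * (max τsig τop) ^ 2 + c₁ ^ (-(2 * s)) * M ^ 2) +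
              8 * (c * (2 * lam + 1))) * η ^ (s * γ) := by ring
          _ ≤ _ := by gcongr

theorem kernelClass_mono {ν Q Q' : ℝ} (h : Q ≤ Q') : kernelClass ν Q ⊆ kernelClass ν Q' :=
  fun _ hg => ⟨hg.1, fun l => ⟨(hg.2 l).1, (hg.2 l).2.trans (by gcongr)⟩⟩

theorem theorem1 (s M ν Q lam C : ℝ) (hs : 1 / 2 < s) (hM : 0 ≤ M) (hν : 0 ≤ ν) (hQ : 0 ≤ Q)
    (hlam : 0 < lam) (hC : 0 ≤ C) :
    ∃ R : ℝ, 0 < R ∧ ∀ κ τsig τop : ℝ, R ≤ κ → R ≤ τsig → R ≤ τop →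
      ∃ A : ℝ, 0 < A ∧
        ∀ (n : ℕ) (σ T δ : ℝ) (t : Fin n → ℝ),
          0 < σ → 0 < T → Monotone t → (∀ i, t i ∈ Set.Icc 0 T) →
          0 < δ → δ ≤ 1 / 2 →
          0 < noiseLevel σ T n → noiseLevel σ T n ≤ 1 / 2 →
          WellConditioned T t (maxLevel lam ν (noiseLevel σ T n) δ) C →
          ∀ (Ω : Type*) [MeasurableSpace Ω] (P : Measure Ω) [IsProbabilityMeasure P]
            (b : ℕ → Ω → ℝ) (ξ : (l : ℕ) → Ω → EuclideanSpace ℝ (Fin (l + 1))),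
            IsNoise P T t (maxLevel lam ν (noiseLevel σ T n) δ) b ξ →
            (⨆ f ∈ sobolevBall s M, ⨆ g ∈ kernelClass ν Q,
                riskI P lam κ τsig τop ν (noiseLevel σ T n) δ b ξ f g) ≤
              ENNReal.ofReal (A * rateI s ν (noiseLevel σ T n) δ) := by
  -- Adding 1 to this bound and to Q keeps both positive when M = 0 or Q = 0.
  set M₁ := sobolevSumBound s M + 1
  have hM₁ : 0 < M₁ := add_pos_of_nonneg_of_pos (by rw [sobolevSumBound]; positivity) one_pos
  have hlog : 0 ≤ Real.log (2 * lam + 1) := Real.log_nonneg (by linarith)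
  set r₁ := 4 * (8 * C * (Q + 1) ^ 2 + 2)
  set r₂ := 128 * (M₁ * (Q + 1))
  set r₃ := 16384 * ((Q + 1) ^ 2 * M₁ * (2 * Real.log (2 * lam + 1) + 1) * (lam ^ (ν + 1) + 1))
  have hr₁ : 0 ≤ r₁ := by positivity
  have hr₂ : 0 ≤ r₂ := by positivity
  have hr₃ : 0 ≤ r₃ := by positivity
  -- 64 serves the tail of ‖B‖, r₁ the signal noise, r₂ the first-order operator noise and r₃ its
  -- quadratic remainder.
  refine ⟨64 + r₁ + r₂ + r₃, by positivity, fun κ τsig τop hκ hτsig hτop => ?_⟩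
  refine ⟨2 * √(9 / 2 * (max τsig τop) ^ 2 + (min
    (((1 + 2 * (Q + 1) * κ * √(2 * Real.log (2 * lam + 1) + 1)) ^ 2)⁻¹ / 2) lam) ^ (-(2 * s)) *
      M ^ 2) + 8 * (majorantConst lam ν M₁ C * (2 * lam + 1)), ?_, ?_⟩
  · have : 0 < majorantConst lam ν M₁ C := by rw [majorantConst]; positivity
    positivity
  · intro n σ T δ t _ hT _ _ hδ hδ1 hε hε1 hwell Ω _ P _ b ξ hnoise
    refine iSup₂_le fun f hf => iSup₂_le fun g hg => ?_
    exact riskI_le hs hM hν hlam hC (lt_add_one _) (by linarith) (by linarith) (by linarith)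
      (by linarith) (by linarith) rfl rfl hT hδ hδ1 hε hε1 hwell hnoise hf
      (kernelClass_mono (by linarith) hg)
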